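/- Theorem 3.6. Let $T:\mathbb N\to\mathbb R$ satisfy $T(n)=o(2^{n/3})$. Let $A$ be a uniformly random permutation oracle: independently for each $n\ge 0$, a uniformly random permutation of $\{0,1\}^n$ is chosen, and $A$ denotes the resulting length-preserving permutation of $\{0,1\}^*$. It is accessed as the Boolean oracle that answers the pair $(x,i)$ (encoded as the string $1^i0x$, $i\ge0$) with the bit of $A(x)$ at position $i$, counting from $0$, and answers $0$ if $i\ge|x|$ or if the query is not a pair. Then with probability $1$ $$\mathrm{NP}^A\cap\mathrm{co\text{-}NP}^A\not\subseteq\mathrm{BQTime}(T(n))^A .$$ More precisely, with probability $1$ the language $\mathcal L_A=\{y:\text{the first bit of }A^{-1}(y)\text{ is }1\}$ belongs to $\mathrm{NP}^A\cap\mathrm{co\text{-}NP}^A$ but not to $\mathrm{BQTime}(T(n))^A$. Here $\mathrm{NP}^A$ is the class of languages with polynomial-time deterministic verifiers that may query $A$ at unit cost, with certificates of polynomial length, and $\mathrm{co\text{-}NP}^A$ is the class of their complements. $\mathrm{BQTime}(T(n))^A$ is the class of languages $L\subseteq\{0,1\}^*$ for which there is a well-formed oracle quantum Turing machine $M$ such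 that, for every $x$, $M^A$ halts on $x$ after some number $t\le T(|x|)$ of steps, and then accepts with probability at least $2/3$ if $x\in L$ and rejects with probability at least $2/3$ if $x\notin L$. An oracle quantum Turing machine has finitely many states, finitely many two-way infinite tapes over $\{0,1,\text{blank}\}$ (among them an input, a query and an output tape), and transition amplitudes whose real and imaginary parts can be approximated to within $2^{-n}$ in time polynomial in $n$. In the pre-query state it passes in one step to the post-query state while the query tape changes from $|x\circ b\rangle$ to $|x\circ(b\oplus A(x))\rangle$ (with $A$ read as a Boolean oracle; nothing on the tape changes if the query tape does not hold a single contiguous non-empty string). It is well-formed if its time evolution preserves Euclidean length, for every Boolean oracle. It halts at time $t$ if the superposition at time $t$ contains only final configurations and at earlier times contains none; it accepts if the start cell of the output tape is then observed to contain $1$, and rejects otherwise. -/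

import Mathlib

open Filter Asymptotics MeasureTheory

noncomputable section

namespace QOracle

/-- The tape `t` contains the string `w`, written from cell `a` rightwards, and is blank elsewhere.
A cell holds a symbol of `{0, 1, blank}`, the blank being `none`. -/
def Holds (t : ℤ → Option Bool) (a : ℤ) (w : List Bool) : Prop :=
  ∀ z : ℤ, t z = if a ≤ z then w[(z - a).toNat]? else none

/-- The tape with the string `w` written from cell `0` rightwards. -/
def written (w : List Bool) : ℤ → Option Bool :=
  fun z => if 0 ≤ z then w[z.toNat]? else none

/-! ### Tapes, configurations, queries -/

/-- What a machine does in one ordinary step: new state, the symbol written by each head, and the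
move of each head (`-1`, `0` or `1`).  The tapes are numbered: `0` is the input tape, `1` the query
tape, `2` the certificate tape (an ordinary work tape unless a certificate is supplied), `3` the
output tape; the other `k` tapes are work tapes. -/
abbrev Action (Q : Type) (k : ℕ) : Type :=
  Q × (Fin (k + 4) → Option Bool) × (Fin (k + 4) → SignType)

/-- A configuration: internal state, head positions, and contents of the two-way infinite tapes. -/
@[ext]
structure Config (Q : Type) (k : ℕ) where
  state : Q
  head : Fin (k + 4) → ℤ
  tape : Fin (k + 4) → ℤ → Option Bool

namespace Config

variable {Q : Type} {k : ℕ}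

/-- All but finitely many cells are blank. -/
def Finitary (c : Config Q k) : Prop :=
  ∀ i, {z : ℤ | c.tape i z ≠ none}.Finite

/-- The symbols scanned by the heads. -/
def read (c : Config Q k) : Fin (k + 4) → Option Bool :=
  fun i => c.tape i (c.head i)

/-- The configuration after an ordinary step. -/
def act (c : Config Q k) (a : Action Q k) : Config Q k where
  state := a.1
  head := fun i => c.head i + (a.2.2 i : ℤ)
  tape := fun i => Function.update (c.tape i) (c.head i) (a.2.1 i)

/-- Start in state `q` with `x` on the input tape, `w` on the certificate tape, all other tapes
blank, and all heads in the start cell `0`. -/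
def start (q : Q) (x w : List Bool) : Config Q k where
  state := q
  head := fun _ => 0
  tape := fun i => written (if i = 0 then x else if i = 2 then w else [])

/-- The start cell of the output tape contains `1`. -/
def OutputsOne (c : Config Q k) : Prop :=
  c.tape 3 0 = some true

end Config

open scoped Classical in
/-- The effect of a call to the Boolean oracle `A` on the query tape: a tape holding the block
`x ∘ b` is changed to `x ∘ (b ⊕ A x)`.  If the query string is empty nothing happens; the same is
stipulated when the non-blank cells do not form one contiguous block. -/
def queryTape (A : List Bool → Bool) (t : ℤ → Option Bool) : ℤ → Option Bool :=
  if h : ∃ p : ℤ × List Bool × Bool, Holds t p.1 (p.2.1 ++ [p.2.2]) then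
    Function.update t (h.choose.1 + h.choose.2.1.length)
      (some (xor h.choose.2.2 (A h.choose.2.1)))
  else t

/-- A tape holds at most one block. -/
theorem Holds.unique {t : ℤ → Option Bool} {a a' : ℤ} {w w' : List Bool} (hw : w ≠ [])
    (hw' : w' ≠ []) (h : Holds t a w) (h' : Holds t a' w') : a = a' ∧ w = w' := by
  have key : ∀ {b b' : ℤ} {v v' : List Bool}, v ≠ [] → Holds t b v → Holds t b' v' → b' ≤ b := by
    intro b b' v v' hv hb hb'
    by_contra hlt
    have e := (hb b).symm.trans (hb' b)
    rw [if_pos le_rfl, if_neg hlt] at e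
    cases v with
    | nil => exact hv rfl
    | cons c v => simp at e
  have ha : a = a' := le_antisymm (key hw' h' h) (key hw h h')
  subst ha
  refine ⟨rfl, List.ext_getElem? fun i => ?_⟩
  have e := (h (a + i)).symm.trans (h' (a + i))
  simpa using e

theorem queryTape_of_holds (A : List Bool → Bool) {t : ℤ → Option Bool} {a : ℤ} {x : List Bool}
    {b : Bool} (h : Holds t a (x ++ [b])) :
    queryTape A t = Function.update t (a + x.length) (some (xor b (A x))) := by
  have hex : ∃ p : ℤ × List Bool × Bool, Holds t p.1 (p.2.1 ++ [p.2.2]) := ⟨(a, x, b), h⟩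
  obtain ⟨h1, h2⟩ := Holds.unique (by simp) (by simp) hex.choose_spec h
  obtain ⟨h3, h4⟩ := List.append_inj' h2 rfl
  rw [queryTape, dif_pos hex, h1, h3, List.singleton_inj.1 h4]

/-- A call to the oracle: only the query tape and the internal state (which becomes `q`) change. -/
def Config.query {Q : Type} {k : ℕ} (A : List Bool → Bool) (q : Q) (c : Config Q k) :
    Config Q k where
  state := q
  head := c.head
  tape := Function.update c.tape 1 (queryTape A (c.tape 1))

/-- The distinguished states of an oracle machine: initial, final, pre-query, post-query. -/
structure Control (Q : Type) where
  init : Q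
  final : Q
  pre : Q
  post : Q
  init_ne_final : init ≠ final
  pre_ne_post : pre ≠ post

/-! ### Deterministic oracle Turing machines, and the classes NP and co-NP -/

/-- A deterministic oracle Turing machine with state set `Q` and `k + 4` tapes. -/
structure DTM (Q : Type) (k : ℕ) extends Control Q where
  δ : Q → (Fin (k + 4) → Option Bool) → Action Q k

namespace DTM

variable {Q : Type} {k : ℕ}

open scoped Classical in
/-- One step; the machine halts in its final state, and a query is executed, in one step, in the
pre-query state. -/
def step (M : DTM Q k) (A : List Bool → Bool) (c : Config Q k) : Config Q k :=
  if c.state = M.final then c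
  else if c.state = M.pre then c.query A M.post
  else c.act (M.δ c.state c.read)

/-- The configuration after `t` steps, on input `x` with certificate `w`. -/
def run (M : DTM Q k) (A : List Bool → Bool) (x w : List Bool) (t : ℕ) : Config Q k :=
  (M.step A)^[t] (Config.start M.init x w)

end DTM

/-- `NP` relative to the oracle `A`: languages with polynomial-time verifiers that may query `A`
(at unit cost) and certificates of polynomial length. -/
def NP (A : List Bool → Bool) : Set (Set (List Bool)) :=
  {L | ∃ (Q : Type) (_ : Finite Q) (k : ℕ) (M : DTM Q k) (p : Polynomial ℕ), ∀ x : List Bool,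
    (∀ w : List Bool, w.length ≤ p.eval x.length →
      (M.run A x w (p.eval x.length)).state = M.final) ∧
    (x ∈ L ↔ ∃ w : List Bool, w.length ≤ p.eval x.length ∧
      (M.run A x w (p.eval x.length)).OutputsOne)}

/-- `co-NP` relative to the oracle `A`. -/
def coNP (A : List Bool → Bool) : Set (Set (List Bool)) :=
  {L | Lᶜ ∈ NP A}

/-! ### Efficiently approximable numbers -/

/-- The integer denoted by a string: a sign bit (`1` for minus) and then the binary digits of the
absolute value, least significant first. -/
def intOf : List Bool → ℤ
  | [] => 0
  | s :: w => (if s then -1 else 1) * ((Nat.ofDigits 2 (w.map Bool.toNat) : ℕ) : ℤ)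

/-- The real number `r` can be approximated to within `2⁻ⁿ` in time polynomial in `n`: some Turing
machine without oracle computes from `1ⁿ`, in time polynomial in `n`, an integer `a` such that
`|r - a / 2ⁿ| ≤ 2⁻ⁿ`. -/
def PolyTimeReal (r : ℝ) : Prop :=
  ∃ (s k : ℕ) (M : DTM (Fin s) k) (p : Polynomial ℕ), ∀ n : ℕ,
    (M.run (fun _ => false) (List.replicate n true) [] (p.eval n)).state = M.final ∧
    ∃ w : List Bool,
      Holds ((M.run (fun _ => false) (List.replicate n true) [] (p.eval n)).tape 3) 0 w ∧
      |r - (intOf w : ℝ) / 2 ^ n| ≤ 1 / 2 ^ n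

/-- The complex numbers whose real and imaginary parts can be approximated to within `2⁻ⁿ` in time
polynomial in `n`. -/
def PolyTimeComplex : Set ℂ :=
  {z | PolyTimeReal z.re ∧ PolyTimeReal z.im}

/-! ### Oracle quantum Turing machines -/

/-- An oracle quantum Turing machine with state set `Q` and `k + 4` tapes: every action has, given
the state and the scanned symbols, an efficiently approximable amplitude. -/
structure QTM (Q : Type) (k : ℕ) extends Control Q where
  amp : Q → (Fin (k + 4) → Option Bool) → Action Q k → ℂ
  amp_mem : ∀ q σ a, amp q σ a ∈ PolyTimeComplex

/-- A (finite) superposition of configurations. -/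
abbrev Superposition (Q : Type) (k : ℕ) : Type := Config Q k →₀ ℂ

/-- The square of the Euclidean length of a superposition. -/
def sqLength {Q : Type} {k : ℕ} (ψ : Superposition Q k) : ℝ :=
  ψ.sum fun _ α => ‖α‖ ^ 2

open scoped Classical in
/-- The probability that a configuration with property `P` is observed. -/
def probOf {Q : Type} {k : ℕ} (ψ : Superposition Q k) (P : Config Q k → Prop) : ℝ :=
  ψ.sum fun c α => if P c then ‖α‖ ^ 2 else 0

namespace QTM

variable {Q : Type} [Fintype Q] {k : ℕ}

open scoped Classical in
/-- The superposition into which a single configuration evolves in one step. -/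
def stepFrom (M : QTM Q k) (A : List Bool → Bool) (c : Config Q k) : Superposition Q k :=
  if c.state = M.pre then Finsupp.single (c.query A M.post) 1
  else ∑ a : Action Q k, Finsupp.single (c.act a) (M.amp c.state c.read a)

/-- The time evolution operator of `M` with oracle `A`. -/
def evolve (M : QTM Q k) (A : List Bool → Bool) : Superposition Q k →ₗ[ℂ] Superposition Q k :=
  Finsupp.linearCombination ℂ (M.stepFrom A)

/-- Well-formed machines: the time evolution preserves Euclidean length, whatever the oracle. -/
def WellFormed (M : QTM Q k) : Prop :=
  ∀ (A : List Bool → Bool) (ψ : Superposition Q k), (∀ c ∈ ψ.support, c.Finitary) →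
    sqLength (M.evolve A ψ) = sqLength ψ

/-- The superposition of `M` with oracle `A` on input `x` at time `t`. -/
def run (M : QTM Q k) (A : List Bool → Bool) (x : List Bool) (t : ℕ) : Superposition Q k :=
  (M.evolve A)^[t] (Finsupp.single (Config.start M.init x []) 1)

/-- `M` with oracle `A` halts on input `x` with running time `t`: at time `t` there are only final
configurations in the superposition, and at any earlier time there are none. -/
def HaltsAt (M : QTM Q k) (A : List Bool → Bool) (x : List Bool) (t : ℕ) : Prop :=
  (∀ c ∈ (M.run A x t).support, c.state = M.final) ∧
    ∀ r < t, ∀ c ∈ (M.run A x r).support, c.state ≠ M.final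

end QTM

/-- `BQTime(T(n))` relative to the oracle `A`: the languages accepted with probability at least
`2/3` by some well-formed oracle quantum Turing machine whose running time with oracle `A` on every
input of length `n` is at most `T n`.  (State sets are taken to be `{0, …, s - 1}`.) -/
def BQTime (T : ℕ → ℝ) (A : List Bool → Bool) : Set (Set (List Bool)) :=
  {L | ∃ (s k : ℕ) (M : QTM (Fin s) k), M.WellFormed ∧ ∀ x : List Bool, ∃ t : ℕ,
    (t : ℝ) ≤ T x.length ∧ M.HaltsAt A x t ∧
    (x ∈ L → 2 / 3 ≤ probOf (M.run A x t) Config.OutputsOne) ∧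
    (x ∉ L → 2 / 3 ≤ probOf (M.run A x t) fun c => ¬ c.OutputsOne)}

/-! ### Random permutation oracles -/

/-- A length-preserving permutation of binary strings: one permutation of `{0,1}ⁿ` for each `n`. -/
abbrev PermFamily : Type := (n : ℕ) → Equiv.Perm (Fin n → Bool)

/-- The length-preserving function on binary strings given by a family of permutations. -/
def PermFamily.toFun (π : PermFamily) (x : List Bool) : List Bool :=
  List.ofFn (π x.length x.get)

/-- The pairing of a string `x` and a number `i`: the string `1ⁱ 0 x`. -/
def pairing (x : List Bool) (i : ℕ) : List Bool :=
  List.replicate i true ++ false :: x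

/-- The inverse of the pairing (`none` on strings that are not pairs). -/
def unpair : List Bool → Option (List Bool × ℕ)
  | [] => none
  | false :: x => some (x, 0)
  | true :: z => (unpair z).map fun p => (p.1, p.2 + 1)

theorem unpair_pairing (x : List Bool) (i : ℕ) : unpair (pairing x i) = some (x, i) := by
  induction i with
  | zero => simp [pairing, unpair]
  | succ i ih =>
    have h : pairing x (i + 1) = true :: pairing x i := by
      simp [pairing, List.replicate_succ]
    rw [h, unpair, ih]
    rfl

/-- The Boolean oracle of a family of permutations: on the pair `(x, i)` it answers with bit number
`i` (counting from `0`) of the value at `x`; it answers `0` if there is no such bit, and on strings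
that are not pairs. -/
def PermFamily.oracle (π : PermFamily) (z : List Bool) : Bool :=
  match unpair z with
  | none => false
  | some (x, i) => (π.toFun x).getD i false

/-- The language of the strings `y` such that the first bit of the preimage of `y` is `1`. -/
def PermFamily.preimageLanguage (π : PermFamily) : Set (List Bool) :=
  {y | ∃ x : List Bool, π.toFun x = y ∧ x.head? = some true}

instance (n : ℕ) : MeasurableSpace (Equiv.Perm (Fin n → Bool)) := ⊤

/-- The law of the uniformly random permutation oracle: independently for each `n`, a uniformly
random permutation of `{0,1}ⁿ`. -/
def randomPerm : Measure PermFamily :=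
  Measure.infinitePi fun n => (PMF.uniformOfFintype (Equiv.Perm (Fin n → Bool))).toMeasure

end QOracle

end

/-! Inverting a permutation of `N = 2 ^ n` points takes on the order of `√N` quantum queries, and
already the first bit of the preimage is that hard. This is an adversary argument. Let `s` be a
permutation and let `s'` arise from it by moving the preimage of `y` to a point `x` with the
opposite first bit. The two oracles differ only at the old and the new preimage. A machine that is
right on both must bring the inner product of its two runs from `1` down to `17 / 18`, and each step
changes it only through the query mass on these two points (`QTM.WellFormed.le_queryMass`). A run of
`K` steps has total mass at most `K`, so on average over `x` the new preimage gets at most `K / N`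
of it. Weighted double counting over all pairs (`mul_card_not_good_ge`) then shows that for `288 * K
≤ √N` the machine fails on at least a quarter of the permutations of length `n`, whatever the oracle
does at other lengths (`QTM.WellFormed.card_decides_le`).

For a fixed machine, success on the string `0ⁿ` within the time bound depends on finitely many
lengths only. Hence lengths can be chosen successively, each outside the dependences of the previous
events, and each multiplies the probability of success by at most `3 / 4`
(`measure_iInter_eq_zero`). So a fixed machine fails almost surely. Since amplitudes come from a
countable set there are countably many machines, and almost surely all of them fail.

Membership in NP and co-NP holds for every oracle: the unique preimage is the certificate, and its
first bit is inspected. -/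

noncomputable section

namespace QOracle

/-! ### The Euclidean geometry of superpositions -/

section Geometry

variable {Q : Type} {k : ℕ}

/-- The real part of the inner product of two superpositions. -/
def reInner (ψ φ : Superposition Q k) : ℝ :=
  ψ.sum fun c α => (star α * φ c).re

theorem sqLength_eq_sum (ψ : Superposition Q k) {S : Finset (Config Q k)} (hS : ψ.support ⊆ S) :
    sqLength ψ = ∑ c ∈ S, ‖ψ c‖ ^ 2 :=
  Finsupp.sum_of_support_subset _ hS _ (by simp)

theorem reInner_eq_sum (ψ φ : Superposition Q k) {S : Finset (Config Q k)} (hS : ψ.support ⊆ S) :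
    reInner ψ φ = ∑ c ∈ S, (star (ψ c) * φ c).re :=
  Finsupp.sum_of_support_subset _ hS _ (by simp)

theorem reInner_add_left (ψ ψ' φ : Superposition Q k) :
    reInner (ψ + ψ') φ = reInner ψ φ + reInner ψ' φ :=
  Finsupp.sum_add_index' (by simp) (by intros; simp [add_mul])

theorem reInner_add_right (ψ φ φ' : Superposition Q k) :
    reInner ψ (φ + φ') = reInner ψ φ + reInner ψ φ' := by
  simp only [reInner, Finsupp.sum, ← Finset.sum_add_distrib, Finsupp.add_apply, mul_add,
    Complex.add_re]

theorem reInner_self (ψ : Superposition Q k) : reInner ψ ψ = sqLength ψ := by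
  refine Finset.sum_congr rfl fun c _ => ?_
  simp [← Complex.normSq_eq_norm_sq, Complex.normSq_apply, Complex.mul_re]

theorem sqLength_add (ψ φ : Superposition Q k) :
    sqLength (ψ + φ) = sqLength ψ + sqLength φ + 2 * reInner ψ φ := by
  classical
  rw [sqLength_eq_sum (ψ + φ) Finsupp.support_add, sqLength_eq_sum ψ Finset.subset_union_left,
    sqLength_eq_sum φ Finset.subset_union_right, reInner_eq_sum ψ φ Finset.subset_union_left,
    Finset.mul_sum, ← Finset.sum_add_distrib, ← Finset.sum_add_distrib]
  refine Finset.sum_congr rfl fun c _ => ?_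
  simp only [← Complex.normSq_eq_norm_sq, Complex.normSq_apply, Finsupp.add_apply,
    Complex.add_re, Complex.add_im, Complex.mul_re, Complex.star_def, Complex.conj_re,
    Complex.conj_im]
  ring

/-- The inequality of arithmetic and geometric means, term by term. Unlike Cauchy–Schwarz it is
linear in the masses, so it can be summed over steps and over permutations with the weight `l`
chosen at the very end. -/
theorem two_mul_abs_reInner_le (ψ φ : Superposition Q k) {l : ℝ} (hl : 0 < l) :
    2 * |reInner ψ φ| ≤ l * sqLength ψ + l⁻¹ * sqLength φ := by
  classical
  rw [sqLength_eq_sum ψ (Finset.subset_union_left (s₂ := φ.support)),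
    sqLength_eq_sum φ (Finset.subset_union_right (s₁ := ψ.support)),
    reInner_eq_sum ψ φ (Finset.subset_union_left (s₂ := φ.support)), Finset.mul_sum,
    Finset.mul_sum, ← Finset.sum_add_distrib]
  calc 2 * |∑ c ∈ ψ.support ∪ φ.support, (star (ψ c) * φ c).re|
      ≤ 2 * ∑ c ∈ ψ.support ∪ φ.support, |(star (ψ c) * φ c).re| := by
        gcongr; exact Finset.abs_sum_le_sum_abs _ _
    _ = ∑ c ∈ ψ.support ∪ φ.support, 2 * |(star (ψ c) * φ c).re| := Finset.mul_sum _ _ _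
    _ ≤ _ := Finset.sum_le_sum fun c _ => ?_
  have h1 : |(star (ψ c) * φ c).re| ≤ ‖ψ c‖ * ‖φ c‖ := by
    refine (Complex.abs_re_le_norm _).trans ?_
    rw [norm_mul, norm_star]
  have h2 : l * ‖ψ c‖ ^ 2 + l⁻¹ * ‖φ c‖ ^ 2 - 2 * (‖ψ c‖ * ‖φ c‖)
      = l⁻¹ * (l * ‖ψ c‖ - ‖φ c‖) ^ 2 := by
    field_simp
    ring
  have h3 : 0 ≤ l⁻¹ * (l * ‖ψ c‖ - ‖φ c‖) ^ 2 := by positivity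
  linarith

theorem sqLength_filter (ψ : Superposition Q k) (P : Config Q k → Prop) [DecidablePred P] :
    sqLength (ψ.filter P) = probOf ψ P := by
  rw [sqLength_eq_sum _ (Finset.filter_subset P ψ.support : _ ⊆ ψ.support), probOf, Finsupp.sum]
  refine Finset.sum_congr rfl fun c _ => ?_
  by_cases h : P c <;> simp [h]

theorem reInner_filter_of_disjoint (ψ φ : Superposition Q k) {P R : Config Q k → Prop}
    [DecidablePred P] [DecidablePred R] (h : ∀ c, P c → ¬ R c) :
    reInner (ψ.filter P) (φ.filter R) = 0 := by
  refine Finset.sum_eq_zero fun c hc => ?_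
  have hP : P c := by
    rw [Finsupp.support_filter, Finset.mem_filter] at hc
    exact hc.2
  simp [h c hP]

theorem probOf_nonneg (ψ : Superposition Q k) (P : Config Q k → Prop) : 0 ≤ probOf ψ P := by
  classical
  exact Finset.sum_nonneg fun c _ => by dsimp only; split_ifs <;> positivity

theorem probOf_add_probOf_not (ψ : Superposition Q k) (P : Config Q k → Prop) :
    probOf ψ P + probOf ψ (fun c => ¬ P c) = sqLength ψ := by
  rw [probOf, probOf, sqLength, Finsupp.sum, Finsupp.sum, Finsupp.sum, ← Finset.sum_add_distrib]
  refine Finset.sum_congr rfl fun c _ => ?_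
  by_cases hP : P c <;> simp [hP]

/-- Pairwise exclusive properties have probabilities of sum at most the total mass. -/
theorem sum_probOf_le {ι : Type*} [Fintype ι] (ψ : Superposition Q k)
    (P : ι → Config Q k → Prop) (h : ∀ c i j, P i c → P j c → i = j) :
    ∑ i, probOf ψ (P i) ≤ sqLength ψ := by
  classical
  simp only [probOf, Finsupp.sum]
  rw [Finset.sum_comm]
  refine Finset.sum_le_sum fun c _ => ?_
  by_cases hc : ∃ i, P i c
  · obtain ⟨i, hi⟩ := hc
    rw [Finset.sum_eq_single i (fun j _ hj => if_neg fun hjc => hj (h c j i hjc hi)) (by simp),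
      if_pos hi]
  · push Not at hc
    rw [Finset.sum_eq_zero fun i _ => if_neg (hc i)]
    positivity

open scoped Classical in
/-- Superpositions that a measurement distinguishes with probability `2/3` are far apart. -/
theorem reInner_le_of_distinguished {ψ φ : Superposition Q k} (hψ : sqLength ψ = 1)
    (hφ : sqLength φ = 1) {P : Config Q k → Prop} (h1 : 2 / 3 ≤ probOf ψ P)
    (h2 : 2 / 3 ≤ probOf φ fun c => ¬ P c) : reInner ψ φ ≤ 17 / 18 := by
  have e : reInner ψ φ = reInner (ψ.filter P) (φ.filter P)
      + reInner (ψ.filter fun c => ¬ P c) (φ.filter fun c => ¬ P c) := by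
    conv_lhs => rw [← Finsupp.filter_add_filter_not ψ P,
      ← Finsupp.filter_add_filter_not φ P]
    rw [reInner_add_left, reInner_add_right, reInner_add_right,
      reInner_filter_of_disjoint ψ φ (P := P) (R := fun c => ¬ P c) (fun c hc hc' => hc' hc),
      reInner_filter_of_disjoint ψ φ (P := fun c => ¬ P c) (R := P) (fun c hc => hc)]
    ring
  -- The optimal weights at probabilities `2 / 3` and `1 / 3` are `1 / √2` and `√2`. The rational
  -- substitutes give `17 / 18` in place of `2 * √2 / 3`.
  have b1 := two_mul_abs_reInner_le (ψ.filter P) (φ.filter P) (l := 2 / 3) (by norm_num)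
  have b2 := two_mul_abs_reInner_le (ψ.filter fun c => ¬ P c) (φ.filter fun c => ¬ P c)
    (l := 3 / 2) (by norm_num)
  rw [sqLength_filter, sqLength_filter] at b1 b2
  have s1 := probOf_add_probOf_not ψ P
  have s2 := probOf_add_probOf_not φ P
  have a1 := le_abs_self (reInner (ψ.filter P) (φ.filter P))
  have a2 := le_abs_self (reInner (ψ.filter fun c => ¬ P c) (φ.filter fun c => ¬ P c))
  norm_num at b1 b2
  linarith

theorem reInner_comm (ψ φ : Superposition Q k) : reInner ψ φ = reInner φ ψ := by
  have h1 := sqLength_add ψ φ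
  have h2 := sqLength_add φ ψ
  rw [add_comm φ ψ] at h2
  linarith

end Geometry

/-! ### Finitary superpositions -/

section Finitary

variable {Q : Type} {k : ℕ}

theorem queryTape_finite (A : List Bool → Bool) {t : ℤ → Option Bool}
    (h : {z : ℤ | t z ≠ none}.Finite) : {z : ℤ | queryTape A t z ≠ none}.Finite := by
  by_cases hex : ∃ p : ℤ × List Bool × Bool, Holds t p.1 (p.2.1 ++ [p.2.2])
  · obtain ⟨p, hp⟩ := hex
    rw [queryTape_of_holds A hp]
    refine (h.insert (p.1 + p.2.1.length)).subset fun z hz => ?_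
    by_cases hzz : z = p.1 + p.2.1.length
    · exact Or.inl hzz
    · rw [Set.mem_ofPred_eq, Function.update_of_ne hzz] at hz
      exact Or.inr hz
  · rwa [queryTape, dif_neg hex]

theorem Config.Finitary.query {c : Config Q k} (h : c.Finitary) (A : List Bool → Bool) (q : Q) :
    (c.query A q).Finitary := by
  intro i
  by_cases hi : i = 1
  · subst hi
    simpa [Config.query] using queryTape_finite A (h 1)
  · simpa [Config.query, Function.update_of_ne hi] using h i

theorem Config.Finitary.act {c : Config Q k} (h : c.Finitary) (a : Action Q k) :
    (c.act a).Finitary := by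
  intro i
  refine ((h i).insert (c.head i)).subset fun z hz => ?_
  by_cases hzz : z = c.head i
  · exact Or.inl hzz
  · simp only [Config.act, Set.mem_ofPred_eq, Function.update_of_ne hzz] at hz
    exact Or.inr hz

theorem written_finite (w : List Bool) : {z : ℤ | written w z ≠ none}.Finite := by
  refine (Set.finite_Icc (0 : ℤ) w.length).subset fun z hz => ?_
  simp only [written, Set.mem_ofPred_eq, ne_eq, ite_eq_right_iff, Classical.not_imp,
    List.getElem?_eq_none_iff, not_le] at hz
  exact ⟨hz.1, by omega⟩

theorem Config.start_finitary (q : Q) (x w : List Bool) :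
    (Config.start q x w : Config Q k).Finitary :=
  fun _ => written_finite _

/-- All configurations in the superposition are finitary. -/
def FinitarySupp (ψ : Superposition Q k) : Prop :=
  ∀ c ∈ ψ.support, c.Finitary

theorem FinitarySupp.add {ψ φ : Superposition Q k} (h : FinitarySupp ψ) (h' : FinitarySupp φ) :
    FinitarySupp (ψ + φ) := by
  classical
  intro c hc
  rcases Finset.mem_union.1 (Finsupp.support_add hc) with h1 | h1
  exacts [h c h1, h' c h1]

theorem FinitarySupp.sum {ι : Type*} (s : Finset ι) (f : ι → Superposition Q k)
    (h : ∀ i ∈ s, FinitarySupp (f i)) : FinitarySupp (∑ i ∈ s, f i) := by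
  classical
  induction s using Finset.induction_on with
  | empty => simp [FinitarySupp]
  | insert i s hi ih =>
    rw [Finset.sum_insert hi]
    exact (h i (by simp)).add (ih fun j hj => h j (by simp [hj]))

theorem FinitarySupp.smul {ψ : Superposition Q k} (h : FinitarySupp ψ) (a : ℂ) :
    FinitarySupp (a • ψ) :=
  fun c hc => h c (Finsupp.support_smul hc)

theorem FinitarySupp.single {c : Config Q k} (h : c.Finitary) (a : ℂ) :
    FinitarySupp (Finsupp.single c a) := by
  intro d hd
  have := Finsupp.support_single_subset hd
  rw [Finset.mem_singleton] at this
  exact this ▸ h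

theorem FinitarySupp.filter {ψ : Superposition Q k} (h : FinitarySupp ψ)
    (P : Config Q k → Prop) [DecidablePred P] : FinitarySupp (ψ.filter P) :=
  fun c hc => h c (Finset.filter_subset P ψ.support hc)

end Finitary

/-! ### Evolution of one machine under different oracles -/

namespace QTM

variable {Q : Type} {k : ℕ}

/-- The configuration is about to query the string `z`. -/
def Asks (M : QTM Q k) (c : Config Q k) (z : List Bool) : Prop :=
  c.state = M.pre ∧ ∃ (a : ℤ) (b : Bool), Holds (c.tape 1) a (z ++ [b])

theorem Asks.unique {M : QTM Q k} {c : Config Q k} {z z' : List Bool} (h : M.Asks c z)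
    (h' : M.Asks c z') : z = z' := by
  obtain ⟨-, a, b, hz⟩ := h
  obtain ⟨-, a', b', hz'⟩ := h'
  exact (List.append_inj' (Holds.unique (by simp) (by simp) hz hz').2 rfl).1

variable [Fintype Q] (M : QTM Q k)

/-- `WellFormed` speaks of finitary configurations only, so finitarity has to be carried along every
run. -/
theorem finitarySupp_evolve (A : List Bool → Bool) {ψ : Superposition Q k}
    (h : FinitarySupp ψ) : FinitarySupp (M.evolve A ψ) := by
  rw [evolve, Finsupp.linearCombination_apply]
  refine FinitarySupp.sum _ _ fun c hc => FinitarySupp.smul ?_ _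
  rw [stepFrom]
  split_ifs
  · exact .single ((h c hc).query A _) _
  · exact .sum _ _ fun a _ => .single ((h c hc).act a) _

theorem run_succ (A : List Bool → Bool) (x : List Bool) (t : ℕ) :
    M.run A x (t + 1) = M.evolve A (M.run A x t) :=
  Function.iterate_succ_apply' _ _ _

theorem finitarySupp_run (A : List Bool → Bool) (x : List Bool) (t : ℕ) :
    FinitarySupp (M.run A x t) := by
  induction t with
  | zero => exact .single (Config.start_finitary _ _ _) _
  | succ t ih => rw [run_succ]; exact M.finitarySupp_evolve A ih

variable {M}

theorem WellFormed.sqLength_run (hM : M.WellFormed) (A : List Bool → Bool) (x : List Bool)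
    (t : ℕ) : sqLength (M.run A x t) = 1 := by
  induction t with
  | zero => simp [run, sqLength]
  | succ t ih => rw [run_succ, hM A _ (M.finitarySupp_run A x t), ih]

/-- Polarization. The real part of the inner product is all that the argument needs. -/
theorem WellFormed.reInner_evolve (hM : M.WellFormed) (A : List Bool → Bool)
    {ψ φ : Superposition Q k} (hψ : FinitarySupp ψ) (hφ : FinitarySupp φ) :
    reInner (M.evolve A ψ) (M.evolve A φ) = reInner ψ φ := by
  have h1 := hM A _ (hψ.add hφ)
  rw [map_add, sqLength_add, sqLength_add, hM A _ hψ, hM A _ hφ] at h1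
  linarith

/-! ### Queries -/

theorem stepFrom_congr {A A' : List Bool → Bool} {c : Config Q k}
    (h : ∀ z, M.Asks c z → A z = A' z) : M.stepFrom A c = M.stepFrom A' c := by
  rw [stepFrom, stepFrom]
  split_ifs with hc
  · have : queryTape A (c.tape 1) = queryTape A' (c.tape 1) := by
      by_cases hex : ∃ p : ℤ × List Bool × Bool, Holds (c.tape 1) p.1 (p.2.1 ++ [p.2.2])
      · obtain ⟨p, hp⟩ := hex
        rw [queryTape_of_holds A hp, queryTape_of_holds A' hp, h _ ⟨hc, _, _, hp⟩]
      · rw [queryTape, queryTape, dif_neg hex, dif_neg hex]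
    rw [Config.query, Config.query, this]
  · rfl

theorem evolve_congr {A A' : List Bool → Bool} {ψ : Superposition Q k}
    (h : ∀ c ∈ ψ.support, ∀ z, M.Asks c z → A z = A' z) : M.evolve A ψ = M.evolve A' ψ := by
  rw [evolve, evolve, Finsupp.linearCombination_apply, Finsupp.linearCombination_apply]
  exact Finset.sum_congr rfl fun c hc => congrArg _ (stepFrom_congr (h c hc))

/-- The configuration is about to query a string with property `P`. -/
def AsksAbout (M : QTM Q k) (P : List Bool → Prop) (c : Config Q k) : Prop :=
  ∃ z, M.Asks c z ∧ P z

/-- The change of the inner product in one step under two oracles. -/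
def gap (M : QTM Q k) (A A' : List Bool → Bool) (ψ φ : Superposition Q k) : ℝ :=
  reInner (M.evolve A ψ) (M.evolve A' φ) - reInner ψ φ

/-- If one oracle `B` answers the queries of both superpositions correctly, both evolve under the
same isometry. `B` will be a hybrid of two oracles, which is why well-formedness is needed for every
oracle. -/
theorem WellFormed.gap_eq_zero (hM : M.WellFormed) {A A' B : List Bool → Bool}
    {ψ φ : Superposition Q k} (hψ : FinitarySupp ψ) (hφ : FinitarySupp φ)
    (h : ∀ c ∈ ψ.support, ∀ z, M.Asks c z → A z = B z)
    (h' : ∀ c ∈ φ.support, ∀ z, M.Asks c z → A' z = B z) : M.gap A A' ψ φ = 0 := by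
  rw [gap, evolve_congr h, evolve_congr h', hM.reInner_evolve B hψ hφ, sub_self]

theorem WellFormed.abs_gap_le (hM : M.WellFormed) (A A' : List Bool → Bool)
    {ψ φ : Superposition Q k} (hψ : FinitarySupp ψ) (hφ : FinitarySupp φ) {l : ℝ} (hl : 0 < l) :
    |M.gap A A' ψ φ| ≤ l * sqLength ψ + l⁻¹ * sqLength φ := by
  have h1 := two_mul_abs_reInner_le ψ φ hl
  have h2 := two_mul_abs_reInner_le (M.evolve A ψ) (M.evolve A' φ) hl
  rw [hM A _ hψ, hM A' _ hφ] at h2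
  have h3 := abs_sub (reInner (M.evolve A ψ) (M.evolve A' φ)) (reInner ψ φ)
  rw [gap]
  linarith

theorem gap_add_add (A A' : List Bool → Bool) (ψ ψ' φ φ' : Superposition Q k) :
    M.gap A A' (ψ + ψ') (φ + φ') =
      M.gap A A' ψ φ + M.gap A A' ψ φ' + (M.gap A A' ψ' φ + M.gap A A' ψ' φ') := by
  simp only [gap, map_add, reInner_add_left, reInner_add_right]
  ring

open scoped Classical in
/-- The change of the inner product splits according to the strings that are queried. -/
theorem WellFormed.gap_split (hM : M.WellFormed) (A A' : List Bool → Bool)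
    {ψ φ : Superposition Q k} (hψ : FinitarySupp ψ) (hφ : FinitarySupp φ)
    (P : List Bool → Prop) :
    M.gap A A' ψ φ = M.gap A A' (ψ.filter (M.AsksAbout P)) (φ.filter (M.AsksAbout P)) +
      M.gap A A' (ψ.filter fun c => ¬ M.AsksAbout P c)
        (φ.filter fun c => ¬ M.AsksAbout P c) := by
  have pos : ∀ (χ : Superposition Q k), ∀ c ∈ (χ.filter (M.AsksAbout P)).support, ∀ z,
      M.Asks c z → P z := by
    intro χ c hc z hz
    rw [Finsupp.support_filter, Finset.mem_filter] at hc
    obtain ⟨z', hz', hP⟩ := hc.2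
    exact hz.unique hz' ▸ hP
  have neg : ∀ (χ : Superposition Q k),
      ∀ c ∈ (χ.filter fun c => ¬ M.AsksAbout P c).support, ∀ z, M.Asks c z → ¬ P z := by
    intro χ c hc z hz hP
    rw [Finsupp.support_filter, Finset.mem_filter] at hc
    exact hc.2 ⟨z, hz, hP⟩
  conv_lhs => rw [← Finsupp.filter_add_filter_not ψ (M.AsksAbout P),
    ← Finsupp.filter_add_filter_not φ (M.AsksAbout P)]
  -- The cross terms vanish: one part asks only inside `P` and the other only outside, so the hybrid
  -- that follows one oracle on `P` and the other off `P` serves both.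
  rw [gap_add_add,
    hM.gap_eq_zero (B := fun z => if P z then A z else A' z) (hψ.filter _) (hφ.filter _)
      (fun c hc z hz => (if_pos (pos ψ c hc z hz)).symm)
      (fun c hc z hz => (if_neg (neg φ c hc z hz)).symm),
    hM.gap_eq_zero (B := fun z => if P z then A' z else A z) (hψ.filter _) (hφ.filter _)
      (fun c hc z hz => (if_neg (neg ψ c hc z hz)).symm)
      (fun c hc z hz => (if_pos (pos φ c hc z hz)).symm)]
  ring

open scoped Classical in
/-- If two oracles agree outside the sets `P₀` and `P₁`, the change of the inner product
is controlled by the mass of the queries in these sets. -/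
theorem WellFormed.abs_gap_le_of_eq_off (hM : M.WellFormed) {A A' : List Bool → Bool}
    {ψ φ : Superposition Q k} (hψ : FinitarySupp ψ) (hφ : FinitarySupp φ)
    {P₀ P₁ : List Bool → Prop} (hA : ∀ z, ¬ P₀ z → ¬ P₁ z → A z = A' z) {l : ℝ} (hl : 0 < l) :
    |M.gap A A' ψ φ| ≤
      l * probOf ψ (M.AsksAbout P₀) + l⁻¹ * probOf φ (M.AsksAbout P₀) +
      (l⁻¹ * probOf ψ (M.AsksAbout P₁) + l * probOf φ (M.AsksAbout P₁)) := by
  -- Peeling off `P₀` before `P₁` makes disjointness of the two sets unnecessary.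
  set ψ' := ψ.filter fun c => ¬ M.AsksAbout P₀ c with hψ'
  set φ' := φ.filter fun c => ¬ M.AsksAbout P₀ c with hφ'
  have fψ' : FinitarySupp ψ' := hψ.filter _
  have fφ' : FinitarySupp φ' := hφ.filter _
  have le : ∀ χ : Superposition Q k,
      sqLength ((χ.filter fun c => ¬ M.AsksAbout P₀ c).filter (M.AsksAbout P₁)) ≤
        probOf χ (M.AsksAbout P₁) := by
    intro χ
    rw [← sqLength_filter χ, sqLength_eq_sum _ (S := χ.support),
      sqLength_eq_sum (χ.filter _) (S := χ.support)]
    · refine Finset.sum_le_sum fun c _ => ?_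
      by_cases h1 : M.AsksAbout P₁ c <;> by_cases h0 : M.AsksAbout P₀ c <;> simp [h1, h0]
    · exact Finset.filter_subset _ _
    · exact (Finset.filter_subset _ _).trans (Finset.filter_subset _ _)
  have z : M.gap A A' (ψ'.filter fun c => ¬ M.AsksAbout P₁ c)
      (φ'.filter fun c => ¬ M.AsksAbout P₁ c) = 0 := by
    refine hM.gap_eq_zero (B := A') (fψ'.filter _) (fφ'.filter _) (fun c hc z hz => ?_)
      fun _ _ _ _ => rfl
    rw [Finsupp.support_filter, Finset.mem_filter, Finsupp.support_filter,
      Finset.mem_filter] at hc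
    exact hA z (fun h => hc.1.2 ⟨z, hz, h⟩) fun h => hc.2 ⟨z, hz, h⟩
  rw [hM.gap_split A A' hψ hφ P₀, hM.gap_split A A' fψ' fφ' P₁, z, add_zero]
  have b0 := hM.abs_gap_le A A' (hψ.filter (M.AsksAbout P₀)) (hφ.filter (M.AsksAbout P₀)) hl
  -- The weight is inverted on `P₁`: in the application `P₀` concerns the preimage under the first
  -- permutation and `P₁` the one under the second, so the two oracles exchange roles.
  have b1 := hM.abs_gap_le A A' (fψ'.filter (M.AsksAbout P₁)) (fφ'.filter (M.AsksAbout P₁))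
    (inv_pos.2 hl)
  rw [sqLength_filter, sqLength_filter] at b0
  rw [inv_inv] at b1
  have c1 := mul_le_mul_of_nonneg_left (le ψ) (inv_pos.2 hl).le
  have c2 := mul_le_mul_of_nonneg_left (le φ) hl.le
  refine (abs_add_le _ _).trans (add_le_add b0 (b1.trans (add_le_add c1 c2)))

end QTM

/-! ### The adversary bound -/

section Counting

open Equiv Finset

variable {X : Type*} [DecidableEq X]

/-- Exchanging the preimage of `y` with `x`, and remembering the old preimage, is an involution. -/
def movePreimage (y : X) : Perm (Perm X × X) :=
  Function.Involutive.toPerm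
    (fun p => (p.1 * swap (p.1.symm y) p.2, p.1.symm y)) fun p => by
      have h : (p.1 * swap (p.1.symm y) p.2).symm y = p.2 := by
        rw [Equiv.symm_apply_eq]
        simp
      refine Prod.ext ?_ h
      simp only [h, mul_assoc]
      rw [swap_comm p.2, swap_mul_self, mul_one]

theorem movePreimage_fst (y : X) (p : Perm X × X) :
    (movePreimage y p).1 = p.1 * swap (p.1.symm y) p.2 := rfl

theorem movePreimage_snd (y : X) (p : Perm X × X) : (movePreimage y p).2 = p.1.symm y := rfl

theorem movePreimage_fst_symm (y : X) (p : Perm X × X) :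
    (movePreimage y p).1.symm y = p.2 := by
  rw [Equiv.symm_apply_eq, movePreimage_fst]
  simp

variable [Fintype X]

/-- If all pairs of good permutations with preimages of `y` of opposite colours are separated by
the query weights `m`, then many permutations are not good. -/
theorem mul_card_not_good_ge (y : X) (h : X → Bool)
    (hh : ∀ b, (2 * #{x | h x ≠ b} : ℝ) = Fintype.card X) (m : Perm X → X → ℝ)
    (hm : ∀ s x, 0 ≤ m s x) {K : ℝ} (hK : ∀ s, ∑ x, m s x ≤ K) {l : ℝ} (hl : 0 < l)
    (G : Perm X → Prop) [DecidablePred G]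
    (hG : ∀ (s : Perm X) (x : X), G s → G (s * swap (s.symm y) x) → h x ≠ h (s.symm y) →
      1 / 18 ≤ l * m s (s.symm y) + l⁻¹ * m (s * swap (s.symm y) x) (s.symm y) +
        (l⁻¹ * m s x + l * m (s * swap (s.symm y) x) x)) :
    (Fintype.card X : ℝ) * (Fintype.card (Perm X) - 2 * #{s | ¬ G s}) ≤
      72 * (Fintype.card (Perm X) * (K * (l * Fintype.card X + l⁻¹))) := by
  set N : ℝ := ((Fintype.card X : ℕ) : ℝ)
  let e := movePreimage y
  let f : Perm X × X → ℝ := fun p => l * m p.1 (p.1.symm y) + l⁻¹ * m p.1 p.2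
  let O : Perm X × X → ℝ := fun p => if h p.2 ≠ h (p.1.symm y) then 1 else 0
  let B : Perm X × X → ℝ := fun p => if G p.1 then 0 else O p
  have hl' := inv_pos.2 hl
  have f0 : ∀ p, 0 ≤ f p := fun p =>
    add_nonneg (mul_nonneg hl.le (hm _ _)) (mul_nonneg hl'.le (hm _ _))
  -- A pair of opposite colours with both ends good pays `1` by `hG`. If one end is not good, the
  -- corresponding `B` already cancels `O p`.
  have key : ∀ p, O p - B p - B (e p) ≤ 18 * (f p + f (e p)) := by
    intro p
    have h0 : 0 ≤ 18 * (f p + f (e p)) := by linarith [f0 p, f0 (e p)]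
    have hO : O (e p) = O p := by
      simp only [O, e, movePreimage_fst_symm, movePreimage_snd, ne_comm]
    have hB : ∀ q, 0 ≤ B q := fun q => by dsimp only [B, O]; split_ifs <;> norm_num
    by_cases g1 : G p.1
    · by_cases g2 : G (e p).1
      · by_cases ho : h p.2 ≠ h (p.1.symm y)
        · have := hG p.1 p.2 g1 g2 ho
          have e1 : f (e p) = l * m (p.1 * swap (p.1.symm y) p.2) p.2 +
              l⁻¹ * m (p.1 * swap (p.1.symm y) p.2) (p.1.symm y) := by
            simp only [f, e, movePreimage_fst_symm]
            rfl
          have o1 : O p = 1 := if_pos ho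
          have : f p = l * m p.1 (p.1.symm y) + l⁻¹ * m p.1 p.2 := rfl
          linarith [hB p, hB (e p)]
        · have o1 : O p = 0 := if_neg ho
          linarith [hB p, hB (e p)]
      · have : B (e p) = O p := by rw [← hO]; exact if_neg g2
        linarith [hB p]
    · have : B p = O p := if_neg g1
      linarith [hB (e p)]
  have sumO : ∀ s : Perm X, 2 * ∑ x, O (s, x) = N := by
    intro s
    rw [← hh (h (s.symm y)), Finset.sum_boole]
  have sO : 2 * ∑ p, O p = Fintype.card (Perm X) * N := by
    rw [Fintype.sum_prod_type, Finset.mul_sum, Finset.sum_congr rfl fun s _ => sumO s]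
    simp [Finset.card_univ]
  have sB : 2 * ∑ p, B p = #{s | ¬ G s} * N := by
    rw [Fintype.sum_prod_type, Finset.mul_sum, ← nsmul_eq_mul, ← Finset.sum_const,
      Finset.sum_filter]
    refine Finset.sum_congr rfl fun s _ => ?_
    by_cases hs : G s
    · simp [B, hs]
    · simp [B, hs, sumO]
  -- For fixed `s`, the mass on its own preimage can be as large as `K` and is counted `N` times,
  -- while the masses on all `x` together are at most `K`. The choice `l = 1 / √N` balances the two
  -- contributions.
  have sf : ∑ p, f p ≤ Fintype.card (Perm X) * (K * (l * N + l⁻¹)) := by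
    rw [Fintype.sum_prod_type, ← nsmul_eq_mul, ← Finset.card_univ, ← Finset.sum_const]
    refine Finset.sum_le_sum fun s _ => ?_
    have h1 : m s (s.symm y) ≤ K :=
      (Finset.single_le_sum (fun x _ => hm s x) (Finset.mem_univ _)).trans (hK s)
    have h2 : ∑ x, f (s, x) = N * (l * m s (s.symm y)) + l⁻¹ * ∑ x, m s x := by
      simp only [f, Finset.sum_add_distrib, Finset.mul_sum, Finset.sum_const, Finset.card_univ,
        nsmul_eq_mul]
      rfl
    have h3 := mul_le_mul_of_nonneg_left h1 (mul_nonneg (Nat.cast_nonneg (Fintype.card X)) hl.le)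
    have h4 := mul_le_mul_of_nonneg_left (hK s) hl'.le
    calc ∑ x, f (s, x) = N * l * m s (s.symm y) + l⁻¹ * ∑ x, m s x := by rw [h2]; ring
      _ ≤ N * l * K + l⁻¹ * K := add_le_add h3 h4
      _ = K * (l * N + l⁻¹) := by ring
  have sfe : ∑ p, f (e p) = ∑ p, f p := Equiv.sum_comp e f
  have sBe : ∑ p, B (e p) = ∑ p, B p := Equiv.sum_comp e B
  have tot := Finset.sum_le_sum fun p (_ : p ∈ (Finset.univ : Finset (Perm X × X))) => key p
  rw [Finset.sum_sub_distrib, Finset.sum_sub_distrib, ← Finset.mul_sum, Finset.sum_add_distrib,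
    sfe, sBe] at tot
  nlinarith

end Counting

section Adversary

variable {Q : Type} [Fintype Q] {k : ℕ}

/-- The machine decides whether `b` holds within `K` steps, on input `x`. -/
def QTM.Decides (M : QTM Q k) (A : List Bool → Bool) (x : List Bool) (K : ℕ) (b : Prop) : Prop :=
  ∃ t ≤ K, M.HaltsAt A x t ∧ (b → 2 / 3 ≤ probOf (M.run A x t) Config.OutputsOne) ∧
    (¬ b → 2 / 3 ≤ probOf (M.run A x t) fun c => ¬ c.OutputsOne)

namespace QTM

variable {M : QTM Q k}

theorem reInner_eq_zero_of_halted {A A' : List Bool → Bool} {x : List Bool} {t : ℕ}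
    (h : ∀ c ∈ (M.run A x t).support, c.state = M.final)
    (h' : ∀ c ∈ (M.run A' x t).support, c.state ≠ M.final) :
    reInner (M.run A x t) (M.run A' x t) = 0 := by
  refine Finset.sum_eq_zero fun c hc => ?_
  have : M.run A' x t c = 0 := by
    by_contra h0
    exact h' c (Finsupp.mem_support_iff.2 h0) (h c hc)
  simp [this]

/-- If the halting times differ, then at the earlier one the first superposition is entirely final
and the other contains no final configuration, so they are orthogonal. If the times agree, the
output measurement distinguishes the runs. -/
theorem WellFormed.exists_reInner_le (hM : M.WellFormed) {A A' : List Bool → Bool}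
    {x : List Bool} {K : ℕ} {b b' : Prop} (h : M.Decides A x K b) (h' : M.Decides A' x K b')
    (hb : b ↔ ¬ b') : ∃ t ≤ K, reInner (M.run A x t) (M.run A' x t) ≤ 17 / 18 := by
  obtain ⟨t, ht, ⟨hf, hn⟩, hy, hno⟩ := h
  obtain ⟨t', ht', ⟨hf', hn'⟩, hy', hno'⟩ := h'
  rcases lt_trichotomy t t' with hlt | rfl | hlt
  · exact ⟨t, ht, by rw [reInner_eq_zero_of_halted hf (hn' t hlt)]; norm_num⟩
  · refine ⟨t, ht, ?_⟩
    by_cases hb0 : b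
    · exact reInner_le_of_distinguished (hM.sqLength_run _ _ _) (hM.sqLength_run _ _ _) (hy hb0)
        (hno' (hb.1 hb0))
    · rw [reInner_comm]
      exact reInner_le_of_distinguished (hM.sqLength_run _ _ _) (hM.sqLength_run _ _ _)
        (hy' (by tauto)) (hno hb0)
  · exact ⟨t', ht', by rw [reInner_comm, reInner_eq_zero_of_halted hf' (hn t' hlt)]; norm_num⟩

/-- The mass of the queries with property `P` in the first `K` steps. -/
def queryMass (M : QTM Q k) (A : List Bool → Bool) (x : List Bool) (K : ℕ)
    (P : List Bool → Prop) : ℝ :=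
  ∑ s ∈ Finset.range K, probOf (M.run A x s) (M.AsksAbout P)

theorem queryMass_nonneg (A : List Bool → Bool) (x : List Bool) (K : ℕ) (P : List Bool → Prop) :
    0 ≤ M.queryMass A x K P :=
  Finset.sum_nonneg fun _ _ => probOf_nonneg _ _

/-- A configuration asks at most one string, so at each time the classes are exclusive and their
masses add up to at most `1`. -/
theorem WellFormed.sum_queryMass_le (hM : M.WellFormed) {ι : Type*} [Fintype ι]
    (A : List Bool → Bool) (x : List Bool) (K : ℕ) (P : ι → List Bool → Prop)
    (hP : ∀ z i j, P i z → P j z → i = j) : ∑ i, M.queryMass A x K (P i) ≤ K := by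
  simp only [queryMass]
  rw [Finset.sum_comm]
  calc _ ≤ ∑ s ∈ Finset.range K, (1 : ℝ) := Finset.sum_le_sum fun s _ => ?_
    _ = K := by simp
  rw [← hM.sqLength_run A x s]
  refine sum_probOf_le _ _ ?_
  rintro c i j ⟨z, hz, hi⟩ ⟨z', hz', hj⟩
  exact hP z i j hi (hz.unique hz' ▸ hj)

/-- To decide differently under two oracles that agree outside `P₀` and `P₁`, a machine has to
query these sets. -/
theorem WellFormed.le_queryMass (hM : M.WellFormed) {A A' : List Bool → Bool}
    {x : List Bool} {K : ℕ} {b b' : Prop} (h : M.Decides A x K b) (h' : M.Decides A' x K b')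
    (hb : b ↔ ¬ b') {P₀ P₁ : List Bool → Prop} (hA : ∀ z, ¬ P₀ z → ¬ P₁ z → A z = A' z)
    {l : ℝ} (hl : 0 < l) :
    1 / 18 ≤ l * M.queryMass A x K P₀ + l⁻¹ * M.queryMass A' x K P₀ +
      (l⁻¹ * M.queryMass A x K P₁ + l * M.queryMass A' x K P₁) := by
  obtain ⟨t, ht, hle⟩ := hM.exists_reInner_le h h' hb
  obtain ⟨β, hβdef⟩ : ∃ β : ℕ → ℝ, ∀ s, β s =
      l * probOf (M.run A x s) (M.AsksAbout P₀) + l⁻¹ * probOf (M.run A' x s) (M.AsksAbout P₀) +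
      (l⁻¹ * probOf (M.run A x s) (M.AsksAbout P₁) +
        l * probOf (M.run A' x s) (M.AsksAbout P₁)) := ⟨_, fun _ => rfl⟩
  have hβ : ∀ s, 0 ≤ β s := fun s => by
    have h1 (B P) := mul_nonneg hl.le (probOf_nonneg (M.run B x s) (M.AsksAbout P))
    have h2 (B P) := mul_nonneg (inv_pos.2 hl).le (probOf_nonneg (M.run B x s) (M.AsksAbout P))
    rw [hβdef]
    exact add_nonneg (add_nonneg (h1 _ _) (h2 _ _)) (add_nonneg (h2 _ _) (h1 _ _))
  have step : ∀ s, reInner (M.run A x s) (M.run A' x s) -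
      reInner (M.run A x (s + 1)) (M.run A' x (s + 1)) ≤ β s := by
    intro s
    have := hM.abs_gap_le_of_eq_off (M.finitarySupp_run A x s) (M.finitarySupp_run A' x s) hA hl
    rw [gap, ← run_succ, ← run_succ, ← hβdef] at this
    linarith [neg_abs_le (reInner (M.run A x (s + 1)) (M.run A' x (s + 1)) -
      reInner (M.run A x s) (M.run A' x s))]
  have init : reInner (M.run A x 0) (M.run A' x 0) = 1 := by
    rw [run, run, Function.iterate_zero, Function.iterate_zero, id_eq, reInner_self]
    simp [sqLength]
  -- Both runs start in the same configuration, so the drop of the inner product from `1`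
  -- telescopes.
  have tel : ∀ r, 1 - reInner (M.run A x r) (M.run A' x r) ≤ ∑ s ∈ Finset.range r, β s := by
    intro r
    induction r with
    | zero => simp [init]
    | succ r ih => rw [Finset.sum_range_succ]; linarith [step r]
  calc (1 / 18 : ℝ) ≤ 1 - reInner (M.run A x t) (M.run A' x t) := by linarith
    _ ≤ ∑ s ∈ Finset.range t, β s := tel t
    _ ≤ ∑ s ∈ Finset.range K, β s :=
      Finset.sum_le_sum_of_subset_of_nonneg (by simpa using ht) fun s _ _ => hβ s
    _ = _ := by simp only [hβdef, queryMass, Finset.sum_add_distrib, Finset.mul_sum]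

end QTM

/-! ### Inverting a random permutation of one length -/

theorem PermFamily.toFun_ofFn (π : PermFamily) {n : ℕ} (v : Fin n → Bool) :
    π.toFun (List.ofFn v) = List.ofFn (π n v) := by
  have key : ∀ (l : List Bool) (h : l.length = n),
      π.toFun l = List.ofFn (π n fun i => l.get (i.cast h.symm)) := by
    rintro l rfl
    rfl
  rw [key _ (List.length_ofFn)]
  congr 2
  funext i
  simp

theorem PermFamily.ofFn_mem_preimageLanguage (π : PermFamily) {n : ℕ} (hn : 0 < n)
    (y : Fin n → Bool) :
    List.ofFn y ∈ π.preimageLanguage ↔ (π n).symm y ⟨0, hn⟩ = true := by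
  obtain ⟨n, rfl⟩ : ∃ m, n = m + 1 := ⟨n - 1, by omega⟩
  constructor
  · rintro ⟨x, hx, hx1⟩
    have hl : x.length = n + 1 := by
      have := congrArg List.length hx
      simpa [PermFamily.toFun] using this
    obtain ⟨v, rfl⟩ : ∃ v : Fin (n + 1) → Bool, x = List.ofFn v :=
      ⟨fun i => x.get (i.cast hl.symm), by
        apply List.ext_getElem
        · simp [hl]
        · intro i h1 h2
          rw [List.getElem_ofFn]
          rfl⟩
    rw [π.toFun_ofFn] at hx
    rw [← List.ofFn_injective hx, Equiv.symm_apply_apply]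
    simpa [List.ofFn_succ] using hx1
  · intro h
    refine ⟨List.ofFn ((π (n + 1)).symm y), ?_, ?_⟩
    · rw [π.toFun_ofFn, Equiv.apply_symm_apply]
    · rw [List.ofFn_succ]
      simpa using h

/-- The query string asks for a bit of the value at `x`. -/
def About {n : ℕ} (x : Fin n → Bool) (z : List Bool) : Prop :=
  ∃ i, unpair z = some (List.ofFn x, i)

theorem About.unique {n : ℕ} {x x' : Fin n → Bool} {z : List Bool} (h : About x z)
    (h' : About x' z) : x = x' := by
  obtain ⟨i, hi⟩ := h
  obtain ⟨j, hj⟩ := h'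
  rw [hi, Option.some_inj, Prod.mk.injEq] at hj
  exact List.ofFn_injective hj.1

/-- Such a string is not a pair, or concerns another length, or concerns a point of length `n` at
which `s` and `s'` agree. -/
theorem oracle_update_eq (π : PermFamily) {n : ℕ} {s s' : Equiv.Perm (Fin n → Bool)}
    {x₀ x₁ : Fin n → Bool} (hs : ∀ x, x ≠ x₀ → x ≠ x₁ → s x = s' x) {z : List Bool}
    (h₀ : ¬ About x₀ z) (h₁ : ¬ About x₁ z) :
    PermFamily.oracle (Function.update π n s) z = PermFamily.oracle (Function.update π n s') z := by
  rw [PermFamily.oracle, PermFamily.oracle]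
  rcases hz : unpair z with _ | ⟨w, i⟩
  · rfl
  · simp only
    congr 1
    by_cases hw : w.length = n
    · obtain ⟨v, rfl⟩ : ∃ v : Fin n → Bool, w = List.ofFn v :=
        ⟨fun i => w.get (i.cast hw.symm), by apply List.ext_getElem <;> simp [hw]⟩
      rw [PermFamily.toFun_ofFn, PermFamily.toFun_ofFn, Function.update_self,
        Function.update_self, hs v]
      · rintro rfl; exact h₀ ⟨i, hz⟩
      · rintro rfl; exact h₁ ⟨i, hz⟩
    · rw [PermFamily.toFun, PermFamily.toFun, Function.update_of_ne hw, Function.update_of_ne hw]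

/-- Flipping coordinate `i` exchanges the two colour classes. -/
theorem two_mul_card_ne {n : ℕ} (i : Fin n) (b : Bool) :
    2 * Finset.card {x : Fin n → Bool | x i ≠ b} = Fintype.card (Fin n → Bool) := by
  have e : Finset.card {x : Fin n → Bool | x i ≠ b} =
      Finset.card {x : Fin n → Bool | ¬ x i ≠ b} := by
    refine Finset.card_bij' (fun x _ => Function.update x i (! x i))
      (fun x _ => Function.update x i (! x i)) ?_ ?_ ?_ ?_
    · intro x hx; simp only [Finset.mem_filter, Finset.mem_univ, true_and] at hx ⊢
      revert hx; cases x i <;> cases b <;> simp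
    · intro x hx; simp only [Finset.mem_filter, Finset.mem_univ, true_and] at hx ⊢
      revert hx; cases x i <;> cases b <;> simp
    · intro x _; simp
    · intro x _; simp
  have := Finset.card_filter_add_card_filter_not (s := (Finset.univ : Finset (Fin n → Bool)))
    (fun x => x i ≠ b)
  rw [Finset.card_univ] at this
  omega

open scoped Classical in
/-- With few queries, a quantum machine finds the first bit of the preimage for at most three
quarters of the permutations of strings of length `n`. -/
theorem QTM.WellFormed.card_decides_le {M : QTM Q k} (hM : M.WellFormed) (π : PermFamily) {n : ℕ}
    (hn : 0 < n) (x : List Bool) (y : Fin n → Bool) {K : ℕ}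
    (hK : 288 * (K : ℝ) ≤ √(2 ^ n)) :
    4 * Finset.card {s : Equiv.Perm (Fin n → Bool) |
      M.Decides (PermFamily.oracle (Function.update π n s)) x K (s.symm y ⟨0, hn⟩ = true)} ≤
    3 * Fintype.card (Equiv.Perm (Fin n → Bool)) := by
  set A : Equiv.Perm (Fin n → Bool) → List Bool → Bool :=
    fun s => PermFamily.oracle (Function.update π n s) with hA
  set G : Equiv.Perm (Fin n → Bool) → Prop :=
    fun s => M.Decides (A s) x K (s.symm y ⟨0, hn⟩ = true) with hGdef
  set r : ℝ := √(2 ^ n) with hr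
  have hr0 : 0 < r := Real.sqrt_pos.2 (by positivity)
  have hrr : r * r = 2 ^ n := Real.mul_self_sqrt (by positivity)
  have hN : (Fintype.card (Fin n → Bool) : ℝ) = r * r := by rw [hrr]; simp
  -- Points are coloured by their first bit. The weight `l = 1 / r` turns `l * N + l⁻¹` into `2 *
  -- r`.
  have main := mul_card_not_good_ge y (fun v => v ⟨0, hn⟩)
    (fun b => by exact_mod_cast two_mul_card_ne ⟨0, hn⟩ b)
    (fun s v => M.queryMass (A s) x K (About v)) (fun s v => M.queryMass_nonneg _ _ _ _) (K := K)
    (fun s => hM.sum_queryMass_le (A s) x K About fun z v v' h h' => h.unique h')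
    (inv_pos.2 hr0) G (by
      intro s v g g' hne
      refine hM.le_queryMass g g' ?_ (fun z h₀ h₁ => oracle_update_eq π ?_ h₀ h₁) (inv_pos.2 hr0)
      · have : (s * Equiv.swap (s.symm y) v).symm y = v := by
          rw [Equiv.symm_apply_eq]; simp
        rw [this]
        revert hne
        cases v ⟨0, hn⟩ <;> cases s.symm y ⟨0, hn⟩ <;> simp
      · intro w hw hw'
        rw [Equiv.Perm.mul_apply, Equiv.swap_apply_of_ne_of_ne hw hw'])
  rw [hN, inv_inv, inv_mul_cancel_left₀ hr0.ne'] at main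
  set P : ℝ := ((Fintype.card (Equiv.Perm (Fin n → Bool)) : ℕ) : ℝ) with hP
  have hP0 : 0 ≤ P := Nat.cast_nonneg _
  have hsplit : (Finset.card {s | G s} : ℝ) + Finset.card {s | ¬ G s} = P := by
    rw [hP, ← Finset.card_univ]
    exact_mod_cast Finset.card_filter_add_card_filter_not (s := Finset.univ) G
  have h1 : r * (r * (P - 2 * Finset.card {s | ¬ G s})) ≤ r * (P * (144 * K)) := by linarith
  have h2 := le_of_mul_le_mul_left h1 hr0
  -- The constant `288` makes `144 * K ≤ r / 2`, which leaves at least a quarter of the permutations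
  -- not good.
  have h3 : r * (P - 2 * Finset.card {s | ¬ G s}) ≤ r * (P / 2) := by nlinarith
  have h4 := le_of_mul_le_mul_left h3 hr0
  have h5 : 4 * (Finset.card {s | G s} : ℝ) ≤ 3 * P := by linarith
  rw [hP] at h5
  exact_mod_cast h5

end Adversary

/-! ### Functions of the oracle that are determined by finitely many answers -/

section FinitelyDetermined

/-- The value depends on finitely many answers of the oracle only. -/
def FinitelyDetermined {α : Type*} (f : (List Bool → Bool) → α) : Prop :=
  ∃ S : Finset (List Bool), ∀ A A' : List Bool → Bool, (∀ z ∈ S, A z = A' z) → f A = f A'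

/-- Queries are adaptive, but `f` takes only finitely many values, one for each set of positive
answers on `S`. The finite sets belonging to these values can therefore be united. -/
theorem FinitelyDetermined.bind {α β : Type*} {f : (List Bool → Bool) → α}
    {g : α → (List Bool → Bool) → β} (hf : FinitelyDetermined f)
    (hg : ∀ a, FinitelyDetermined (g a)) : FinitelyDetermined fun A => g (f A) A := by
  classical
  obtain ⟨S, hS⟩ := hf
  choose R hR using hg
  refine ⟨S ∪ S.powerset.biUnion fun U => R (f fun z => decide (z ∈ U)), fun A A' h => ?_⟩
  have e1 : f A = f A' := hS A A' fun z hz => h z (Finset.mem_union_left _ hz)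
  have e2 : f A = f fun z => decide (z ∈ S.filter fun z => A z = true) :=
    hS _ _ fun z hz => by simp [hz]
  simp only [← e1]
  refine hR _ A A' fun z hz => h z (Finset.mem_union_right _ ?_)
  rw [Finset.mem_biUnion]
  exact ⟨S.filter fun z => A z = true, Finset.mem_powerset.2 (Finset.filter_subset _ _), e2 ▸ hz⟩

theorem FinitelyDetermined.exists_uniform {α : Type*} {f : ℕ → (List Bool → Bool) → α}
    (hf : ∀ t, FinitelyDetermined (f t)) (K : ℕ) : ∃ S : Finset (List Bool),
      ∀ A A' : List Bool → Bool, (∀ z ∈ S, A z = A' z) → ∀ t ≤ K, f t A = f t A' := by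
  classical
  choose S hS using hf
  exact ⟨(Finset.range (K + 1)).biUnion S, fun A A' h t ht =>
    hS t A A' fun z hz => h z (Finset.mem_biUnion.2 ⟨t, by simpa using by omega, hz⟩)⟩

variable {Q : Type} [Fintype Q] {k : ℕ} (M : QTM Q k)

theorem QTM.finitelyDetermined_evolve (ψ : Superposition Q k) :
    FinitelyDetermined fun A => M.evolve A ψ := by
  have fin : {z | ∃ c ∈ ψ.support, M.Asks c z}.Finite := by
    have : {z | ∃ c ∈ ψ.support, M.Asks c z} = ⋃ c ∈ ψ.support, {z | M.Asks c z} := by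
      ext z; simp
    rw [this]
    exact Set.Finite.biUnion ψ.support.finite_toSet fun c _ =>
      Set.Subsingleton.finite fun z hz z' hz' => Asks.unique hz hz'
  exact ⟨fin.toFinset, fun A A' h => evolve_congr fun c hc z hz =>
    h z (fin.mem_toFinset.2 ⟨c, hc, hz⟩)⟩

theorem QTM.finitelyDetermined_run (x : List Bool) (t : ℕ) :
    FinitelyDetermined fun A => M.run A x t := by
  induction t with
  | zero => exact ⟨∅, fun A A' _ => by simp only [run, Function.iterate_zero]⟩
  | succ t ih =>
    have e : (fun A => M.run A x (t + 1)) = fun A => M.evolve A (M.run A x t) :=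
      funext fun A => M.run_succ A x t
    rw [e]
    exact ih.bind (g := fun ψ A => M.evolve A ψ) M.finitelyDetermined_evolve

/-- The proposition to be decided is left as an argument, since it will itself depend on the
permutation. -/
theorem QTM.finitelyDetermined_decides (x : List Bool) (K : ℕ) :
    FinitelyDetermined fun A => M.Decides A x K := by
  obtain ⟨S, hS⟩ := FinitelyDetermined.exists_uniform (M.finitelyDetermined_run x) K
  have imp : ∀ A A' : List Bool → Bool, (∀ z ∈ S, A z = A' z) → ∀ b,
      M.Decides A x K b → M.Decides A' x K b := by
    rintro A A' h b ⟨t, ht, ⟨h1, h2⟩, h3, h4⟩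
    have e := hS A A' h
    refine ⟨t, ht, ⟨?_, fun r hr => ?_⟩, ?_⟩
    · rw [← e t ht]; exact h1
    · rw [← e r (hr.le.trans ht)]; exact h2 r hr
    · rw [← e t ht]; exact ⟨h3, h4⟩
  exact ⟨S, fun A A' h => funext fun b =>
    propext ⟨imp A A' h b, imp A' A (fun z hz => (h z hz).symm) b⟩⟩

/-- A finitely determined function of the oracle of a family of permutations depends on finitely
many of the permutations only. -/
theorem FinitelyDetermined.dependsOn {α : Type*} {f : (List Bool → Bool) → α}
    (hf : FinitelyDetermined f) :
    ∃ I : Finset ℕ, DependsOn (fun π : PermFamily => f π.oracle) (I : Set ℕ) := by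
  obtain ⟨S, hS⟩ := hf
  -- A string that is not a pair contributes the harmless length `0`, as its answer is always
  -- `false`.
  refine ⟨S.image fun z => ((unpair z).map fun p => p.1.length).getD 0, fun π π' h =>
    hS _ _ fun z hz => ?_⟩
  rw [PermFamily.oracle, PermFamily.oracle]
  rcases hz' : unpair z with _ | ⟨w, i⟩
  · rfl
  · have : π w.length = π' w.length :=
      h _ (by rw [Finset.coe_image]; exact ⟨z, hz, by simp [hz']⟩)
    simp only [PermFamily.toFun, this]

end FinitelyDetermined

/-! ### Events for the random permutation oracle -/

section Measure

instance (n : ℕ) : DiscreteMeasurableSpace (Equiv.Perm (Fin n → Bool)) := ⟨fun _ => trivial⟩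

/-- The event is a cylinder over a finite product of finite discrete spaces. -/
theorem measurableSet_of_dependsOn {E : Set PermFamily} {I : Finset ℕ}
    (h : DependsOn (· ∈ E) (I : Set ℕ)) : MeasurableSet E := by
  have e : E = I.restrict ⁻¹' (I.restrict '' E) := by
    refine Set.Subset.antisymm (Set.subset_preimage_image _ _) ?_
    rintro π ⟨π', hπ', he⟩
    have : (π' ∈ E) = (π ∈ E) := h fun i hi => congrFun he ⟨i, hi⟩
    rwa [← this]
  rw [e]
  exact Finset.measurable_restrict I ((Set.toFinite _).measurableSet)

instance : IsProbabilityMeasure randomPerm := by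
  unfold randomPerm; infer_instance

/-- Multiplying one of the permutations by a fixed permutation preserves the law. -/
theorem measurePreserving_update_mul (n : ℕ) (r : Equiv.Perm (Fin n → Bool)) :
    MeasurePreserving (fun π : PermFamily => Function.update π n (π n * r)) randomPerm
      randomPerm := by
  classical
  -- The map is a product of bijections of the coordinates, each of which preserves the uniform law.
  let f : ∀ i, Equiv.Perm (Fin i → Bool) → Equiv.Perm (Fin i → Bool) := fun i s =>
    if h : i = n then s * (h ▸ r) else s
  have hf : ∀ i, Function.Bijective (f i) := by
    intro i
    by_cases h : i = n
    · subst h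
      have : f i = fun s => s * r := by funext s; simp [f]
      rw [this]
      exact (Equiv.mulRight r).bijective
    · have : f i = id := by funext s; simp [f, h]
      rw [this]
      exact Function.bijective_id
  have e : (fun π : PermFamily => Function.update π n (π n * r)) = fun π i => f i (π i) := by
    funext π i
    by_cases h : i = n
    · subst h; simp [f]
    · simp [f, h]
  have hmap : ∀ i, ((PMF.uniformOfFintype (Equiv.Perm (Fin i → Bool))).toMeasure).map (f i) =
      (PMF.uniformOfFintype (Equiv.Perm (Fin i → Bool))).toMeasure := by
    intro i
    refine Measure.ext_of_singleton fun s => ?_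
    rw [Measure.map_apply (measurable_of_finite _) (measurableSet_singleton _)]
    obtain ⟨s', rfl⟩ := (hf i).2 s
    have : f i ⁻¹' {f i s'} = {s'} := by
      ext u; simp [(hf i).1.eq_iff]
    rw [this, PMF.toMeasure_apply_singleton _ _ (measurableSet_singleton _),
      PMF.toMeasure_apply_singleton _ _ (measurableSet_singleton _)]
    simp
  rw [e]
  refine ⟨by fun_prop, ?_⟩
  rw [randomPerm, Measure.infinitePi_map_pi _ fun i => measurable_of_finite (f i)]
  simp only [hmap]

open scoped Classical in
/-- An event that has at most the fraction `3/4` in each fibre over the other permutations. -/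
theorem four_mul_measure_inter_le {n : ℕ} {E F : Set PermFamily} (hE : MeasurableSet E)
    (hF : MeasurableSet F) (hFn : ∀ π s, Function.update π n s ∈ F ↔ π ∈ F)
    (hEn : ∀ π : PermFamily, 4 * Finset.card {s | Function.update π n s ∈ E} ≤
      3 * Fintype.card (Equiv.Perm (Fin n → Bool))) :
    4 * randomPerm (F ∩ E) ≤ 3 * randomPerm F := by
  set P := Equiv.Perm (Fin n → Bool)
  have hmeas : ∀ r : P, Measurable fun π : PermFamily => Function.update π n (π n * r) :=
    fun r => (measurePreserving_update_mul n r).measurable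
  -- Averaging over the multiplications by `r`, which preserve the law and the event `F`, replaces
  -- conditioning on the other coordinates.
  have h1 : ∀ r : P, randomPerm (F ∩ E) =
      ∫⁻ π, F.indicator (fun π => if Function.update π n (π n * r) ∈ E then (1 : ENNReal) else 0) π
        ∂randomPerm := by
    intro r
    rw [← (measurePreserving_update_mul n r).measure_preimage (hF.inter hE).nullMeasurableSet,
      ← lintegral_indicator_one ((hmeas r) (hF.inter hE))]
    refine lintegral_congr fun π => ?_
    by_cases hπ : π ∈ F
    · by_cases hπ' : Function.update π n (π n * r) ∈ E
      · simp [Set.indicator, hπ, hFn, hπ']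
      · simp [Set.indicator, hπ, hFn, hπ']
    · simp [Set.indicator, hπ, hFn]
  have h2 : (Fintype.card P : ENNReal) * (4 * randomPerm (F ∩ E)) ≤
      Fintype.card P * (3 * randomPerm F) := by
    calc (Fintype.card P : ENNReal) * (4 * randomPerm (F ∩ E))
        = 4 * ∑ _r : P, randomPerm (F ∩ E) := by
          rw [Finset.sum_const, Finset.card_univ, nsmul_eq_mul]; ring
      _ = 4 * ∫⁻ π, ∑ r : P, F.indicator (fun π =>
            if Function.update π n (π n * r) ∈ E then (1 : ENNReal) else 0) π ∂randomPerm := by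
          rw [lintegral_finsetSum]
          · rw [Finset.sum_congr rfl fun r _ => h1 r]
          · intro r _
            exact (Measurable.ite ((hmeas r) hE) measurable_const measurable_const).indicator hF
      _ = ∫⁻ π, 4 * ∑ r : P, F.indicator (fun π =>
            if Function.update π n (π n * r) ∈ E then (1 : ENNReal) else 0) π ∂randomPerm := by
          rw [lintegral_const_mul']
          simp
      _ ≤ ∫⁻ π, F.indicator (fun _ => (3 * Fintype.card P : ENNReal)) π ∂randomPerm := by
          refine lintegral_mono fun π => ?_
          by_cases hπ : π ∈ F
          · simp only [Set.indicator_of_mem hπ]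
            -- As `r` varies, `π n * r` runs through all permutations, so the average is the
            -- proportion of `E` in the fibre.
            have e : (∑ r : P, if Function.update π n (π n * r) ∈ E then (1 : ENNReal) else 0) =
                ∑ s : P, if Function.update π n s ∈ E then (1 : ENNReal) else 0 :=
              Equiv.sum_comp (Equiv.mulLeft (π n))
                (fun s : P => if Function.update π n s ∈ E then (1 : ENNReal) else 0)
            rw [e, Finset.sum_boole]
            exact_mod_cast hEn π
          · simp [Set.indicator_of_notMem hπ]
      _ = Fintype.card P * (3 * randomPerm F) := by
          rw [lintegral_indicator_const hF]; ring
  exact (ENNReal.mul_le_mul_iff_right (by simp) (by simp)).1 h2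

open scoped Classical in
/-- If, for all large `n`, the event `E n` depends on finitely many permutations and is missed by a
quarter of the choices for the permutation number `n`, then almost surely not all `E n` happen. -/
theorem measure_iInter_eq_zero {E : ℕ → Set PermFamily} {n₀ : ℕ}
    (hdep : ∀ n, n₀ ≤ n → ∃ I : Finset ℕ, DependsOn (· ∈ E n) (I : Set ℕ))
    (hE : ∀ n, n₀ ≤ n → ∀ π : PermFamily, 4 * Finset.card {s | Function.update π n s ∈ E n} ≤
      3 * Fintype.card (Equiv.Perm (Fin n → Bool))) :
    randomPerm (⋂ n, E n) = 0 := by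
  have key : ∀ j : ℕ, ∃ F : Set PermFamily, (⋂ n, E n) ⊆ F ∧
      (∃ I : Finset ℕ, DependsOn (· ∈ F) (I : Set ℕ)) ∧ randomPerm F ≤ (3 / 4) ^ j := by
    intro j
    induction j with
    | zero => exact ⟨Set.univ, Set.subset_univ _, ⟨∅, fun _ _ _ => rfl⟩, by simp⟩
    | succ j ih =>
      obtain ⟨F, hF, ⟨I, hI⟩, hp⟩ := ih
      -- A length that `F` does not see: given `F`, the permutation of this length is still uniform.
      obtain ⟨n, hn, hnI⟩ : ∃ n, n₀ ≤ n ∧ n ∉ I := by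
        obtain ⟨n, hn⟩ := Infinite.exists_notMem_finset (I ∪ Finset.range n₀)
        simp only [Finset.mem_union, Finset.mem_range, not_or, not_lt] at hn
        exact ⟨n, hn.2, hn.1⟩
      obtain ⟨J, hJ⟩ := hdep n hn
      refine ⟨F ∩ E n, Set.subset_inter hF (Set.iInter_subset _ _), ⟨I ∪ J, ?_⟩, ?_⟩
      · intro π π' h
        have e1 : (π ∈ F) = (π' ∈ F) := hI fun i hi => h i (by simp_all)
        have e2 : (π ∈ E n) = (π' ∈ E n) := hJ fun i hi => h i (by simp_all)
        simp only [Set.mem_inter_iff, e1, e2]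
      · have h4 := four_mul_measure_inter_le (measurableSet_of_dependsOn hJ)
          (measurableSet_of_dependsOn hI) (n := n) (fun π s => ?_) (hE n hn)
        · calc randomPerm (F ∩ E n) = 4⁻¹ * (4 * randomPerm (F ∩ E n)) := by
                rw [← mul_assoc, ENNReal.inv_mul_cancel (by simp) (by simp), one_mul]
            _ ≤ 4⁻¹ * (3 * (3 / 4) ^ j) := by
                refine mul_le_mul_right (h4.trans ?_) _
                exact mul_le_mul_right hp _
            _ = (3 / 4) ^ (j + 1) := by rw [pow_succ, ENNReal.div_eq_inv_mul]; ring
        · refine iff_of_eq (hI fun i hi => ?_)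
          rw [Function.update_of_ne]
          rintro rfl
          exact hnI hi
  have lim : Tendsto (fun j : ℕ => (3 / 4 : ENNReal) ^ j) atTop (nhds 0) :=
    ENNReal.tendsto_pow_atTop_nhds_zero_of_lt_one
      (ENNReal.div_lt_of_lt_mul (by norm_num))
  refine le_antisymm (ge_of_tendsto' lim fun j => ?_) zero_le
  obtain ⟨F, hF, -, hp⟩ := key j
  exact (measure_mono hF).trans hp

end Measure

/-! ### There are countably many machines -/

section Countable

instance {Q : Type} [Countable Q] : Countable (Control Q) :=
  Function.Injective.countable (f := fun c : Control Q => (c.init, c.final, c.pre, c.post)) <| by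
    rintro ⟨a, b, c, d, h, h'⟩ ⟨a', b', c', d', i, i'⟩ e
    simpa using e

instance {Q : Type} [Finite Q] {k : ℕ} : Countable (DTM Q k) :=
  Function.Injective.countable (f := fun M : DTM Q k => (M.toControl, M.δ)) <| by
    rintro ⟨c, δ⟩ ⟨c', δ'⟩ e
    simpa using e

/-- The machine approximates `r` to within `2⁻ⁿ` in the given polynomial time. -/
def Approximates (u : Σ (s : ℕ) (k : ℕ), DTM (Fin s) k × Polynomial ℕ) (r : ℝ) : Prop :=
  ∀ n : ℕ, ∃ w : List Bool, Holds ((u.2.2.1.run (fun _ => false) (List.replicate n true) []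
    (u.2.2.2.eval n)).tape 3) 0 w ∧ |r - (intOf w : ℝ) / 2 ^ n| ≤ 1 / 2 ^ n

/-- For each `n` the deterministic machine leaves one output, and both numbers are within `2⁻ⁿ` of
the same fraction. The start cell `0` is fixed, so even an empty output is unambiguous. -/
theorem Approximates.unique {u : Σ (s : ℕ) (k : ℕ), DTM (Fin s) k × Polynomial ℕ} {r r' : ℝ}
    (h : Approximates u r) (h' : Approximates u r') : r = r' := by
  have hlim : ∀ n : ℕ, |r - r'| ≤ 2 * (1 / 2) ^ n := by
    intro n
    obtain ⟨w, hw, hr⟩ := h n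
    obtain ⟨w', hw', hr'⟩ := h' n
    have hww : w = w' := by
      refine List.ext_getElem? fun i => ?_
      have := (hw i).symm.trans (hw' i)
      simpa using this
    subst hww
    have := abs_sub_le r ((intOf w : ℝ) / 2 ^ n) r'
    rw [abs_sub_comm ((intOf w : ℝ) / 2 ^ n) r'] at this
    rw [one_div_pow]
    linarith
  have lim : Tendsto (fun n : ℕ => 2 * (1 / 2 : ℝ) ^ n) atTop (nhds 0) := by
    simpa using (tendsto_pow_atTop_nhds_zero_of_lt_one (r := (1 / 2 : ℝ)) (by norm_num)
      (by norm_num)).const_mul 2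
  exact sub_eq_zero.1 (abs_nonpos_iff.1 (ge_of_tendsto' lim hlim))

theorem polyTimeReal_countable : {r : ℝ | PolyTimeReal r}.Countable := by
  have ex : ∀ r : {r : ℝ | PolyTimeReal r}, ∃ u, Approximates u r := by
    rintro ⟨r, s, k, M, p, h⟩
    exact ⟨⟨s, k, M, p⟩, fun n => (h n).2⟩
  choose f hu using ex
  have hf : Function.Injective f := fun r r' e =>
    Subtype.ext ((hu r).unique (e ▸ hu r'))
  have : Countable (Polynomial ℕ) := Function.Injective.countable
    (f := fun q : Polynomial ℕ => (List.range (q.natDegree + 1)).map q.coeff)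
    (by
      intro a b h
      have hd : a.natDegree = b.natDegree := by simpa using congrArg List.length h
      ext n
      by_cases hn : n ≤ a.natDegree
      · simpa [hd ▸ hn, hn] using congrArg (fun l => l[n]?) h
      · rw [Polynomial.coeff_eq_zero_of_natDegree_lt (by omega),
          Polynomial.coeff_eq_zero_of_natDegree_lt (by omega)])
  exact hf.countable

theorem polyTimeComplex_countable : PolyTimeComplex.Countable := by
  have := polyTimeReal_countable.prod polyTimeReal_countable
  refine (this.preimage Complex.equivRealProd.injective).mono fun z hz => hz

/-- The amplitude table is finite with entries in a countable set. Only here does the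
approximability of the amplitudes matter. -/
instance {Q : Type} [Finite Q] {k : ℕ} : Countable (QTM Q k) := by
  have : Countable PolyTimeComplex := polyTimeComplex_countable
  refine Function.Injective.countable (f := fun M : QTM Q k => (M.toControl,
    fun q σ a => (⟨M.amp q σ a, M.amp_mem q σ a⟩ : PolyTimeComplex))) ?_
  rintro ⟨c, amp, h⟩ ⟨c', amp', h'⟩ e
  simp only [Prod.mk.injEq] at e
  obtain ⟨rfl, e⟩ := e
  congr
  funext q σ a
  exact congrArg Subtype.val (congrFun (congrFun (congrFun e q) σ) a)

end Countable

/-! ### The language of preimages is in NP and co-NP -/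

section Strip

/-- The tape with the string `u` written from cell `a` rightwards. -/
def strip (a : ℤ) (u : List Bool) : ℤ → Option Bool :=
  fun z => if a ≤ z then u[(z - a).toNat]? else none

theorem written_eq_strip (u : List Bool) : written u = strip 0 u := by
  funext z; simp [written, strip]

theorem strip_eq_none_iff {a : ℤ} {u : List Bool} {z : ℤ} :
    strip a u z = none ↔ z < a ∨ a + u.length ≤ z := by
  simp only [strip, ite_eq_right_iff, List.getElem?_eq_none_iff]
  omega

theorem strip_append_singleton (a : ℤ) (u : List Bool) (b : Bool) :
    strip a (u ++ [b]) (a + u.length) = some b := by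
  simp [strip]

theorem update_strip_append (a : ℤ) (u : List Bool) (b c : Bool) :
    Function.update (strip a (u ++ [c])) (a + u.length) (some b) = strip a (u ++ [b]) := by
  funext z
  by_cases hz : z = a + u.length
  · subst hz; rw [Function.update_self, strip_append_singleton]
  · rw [Function.update_of_ne hz, strip, strip]
    split_ifs with h
    · simp only [List.getElem?_append]
      split_ifs with h1
      · rfl
      · have : ∃ m, (z - a).toNat - u.length = m + 1 := ⟨(z - a).toNat - u.length - 1, by omega⟩
        obtain ⟨m, hm⟩ := this
        simp [hm]
    · rfl

theorem update_strip_length (a : ℤ) (u : List Bool) (b : Bool) :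
    Function.update (strip a u) (a + u.length) (some b) = strip a (u ++ [b]) := by
  rw [← update_strip_append a u b b]
  funext z
  by_cases hz : z = a + u.length
  · subst hz; rw [Function.update_self, Function.update_self]
  · rw [Function.update_of_ne hz, Function.update_of_ne hz, strip, strip]
    split_ifs with h
    · rw [List.getElem?_append]
      split_ifs with h1
      · rfl
      · rw [List.getElem?_eq_none (by omega), List.getElem?_eq_none (by simp; omega)]
    · rfl

theorem update_strip_pred (a : ℤ) (u : List Bool) (b : Bool) :
    Function.update (strip a u) (a - 1) (some b) = strip (a - 1) (b :: u) := by
  funext z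
  by_cases hz : z = a - 1
  · subst hz; simp [strip]
  · rw [Function.update_of_ne hz, strip, strip]
    by_cases h : a ≤ z
    · rw [if_pos h, if_pos (by omega), show (z - (a - 1)).toNat = (z - a).toNat + 1 by omega,
        List.getElem?_cons_succ]
    · rw [if_neg h, if_neg (by omega)]

theorem holds_strip (a : ℤ) (u : List Bool) : Holds (strip a u) a u := fun _ => rfl

theorem queryTape_strip (A : List Bool → Bool) (a : ℤ) (u : List Bool) :
    queryTape A (strip a (u ++ [false])) = strip a (u ++ [A u]) := by
  rw [queryTape_of_holds A (holds_strip a _), update_strip_append, Bool.false_xor]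

end Strip

/-- The states of the verifier. -/
inductive VState
  | scan | copy | rewind | test | ask | check | left | right | done
  deriving DecidableEq

instance : Fintype VState :=
  ⟨{.scan, .copy, .rewind, .test, .ask, .check, .left, .right, .done}, by
    intro x; cases x <;> decide⟩

/-- The verifier checks that the certificate is a preimage of the input, and that the answer to
the question whether the certificate starts with `1` is `d`.  It keeps `1ⁱ 0 w b` on the query
tape, where `w` is the certificate, and compares the answers with the bits of the input. -/
def verifier (d : Bool) : DTM VState 0 where
  init := .scan
  final := .done
  pre := .ask
  post := .check
  init_ne_final := by decide
  pre_ne_post := by decide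
  δ q s :=
    match q with
    -- Cell `0` of the query tape receives the separator `0` of the pairing.
    | .scan =>
      if decide (s 2 = some true) = d then
        (.copy, ![s 0, some false, s 2, s 3], ![0, 1, 0, 0])
      else (.done, ![s 0, s 1, s 2, s 3], ![0, 0, 0, 0])
    -- The input and certificate heads advance together, so a difference of lengths shows as soon as
    -- one of them reaches a blank. At the end the answer cell is initialised to `0`.
    | .copy =>
      match s 0, s 2 with
      | some _, some b => (.copy, ![s 0, some b, s 2, s 3], ![1, 1, 1, 0])
      | none, none => (.rewind, ![s 0, some false, s 2, s 3], ![-1, 0, 0, 0])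
      | _, _ => (.done, ![s 0, s 1, s 2, s 3], ![0, 0, 0, 0])
    | .rewind =>
      if s 0 = none then (.test, ![s 0, s 1, s 2, s 3], ![1, 0, 0, 0])
      else (.rewind, ![s 0, s 1, s 2, s 3], ![-1, 0, 0, 0])
    | .test =>
      if s 0 = none then (.done, ![s 0, s 1, s 2, some true], ![0, 0, 0, 0])
      else (.ask, ![s 0, s 1, s 2, s 3], ![0, 0, 0, 0])
    -- The answer cell is reset to `0`, so that the next query, which adds modulo `2`, again leaves
    -- the plain answer there.
    | .check =>
      if s 0 = s 1 then (.left, ![s 0, some false, s 2, s 3], ![1, -1, 0, 0])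
      else (.done, ![s 0, s 1, s 2, s 3], ![0, 0, 0, 0])
    -- A `1` is put in front of the block, which raises the index of the bit asked for. The state
    -- `right` then returns to the answer cell.
    | .left =>
      if s 1 = none then (.right, ![s 0, some true, s 2, s 3], ![0, 1, 0, 0])
      else (.left, ![s 0, s 1, s 2, s 3], ![0, -1, 0, 0])
    | .right =>
      if s 1 = none then (.test, ![s 0, s 1, s 2, s 3], ![0, -1, 0, 0])
      else (.right, ![s 0, s 1, s 2, s 3], ![0, 1, 0, 0])
    -- The last two entries are dummies: `DTM.step` treats the pre-query and final states
    -- separately.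
    | .ask => (.done, ![s 0, s 1, s 2, s 3], ![0, 0, 0, 0])
    | .done => (.done, ![s 0, s 1, s 2, s 3], ![0, 0, 0, 0])

/-! ### Single steps of the verifier -/

namespace Verifier

variable (y w : List Bool)

/-- The configurations of the verifier on input `y` with certificate `w`. -/
def cfg (q : VState) (a b c : ℤ) (t o : ℤ → Option Bool) : Config VState 0 where
  state := q
  head := ![a, b, c, 0]
  tape := ![written y, t, written w, o]

theorem act_cfg (q q' : VState) (a b c : ℤ) (t o : ℤ → Option Bool) (s e : Option Bool)
    (i j l : SignType) :
    (cfg y w q a b c t o).act (q', ![written y a, s, written w c, e], ![i, j, l, 0]) =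
      cfg y w q' (a + i) (b + j) (c + l) (Function.update t b s) (Function.update o 0 e) := by
  ext x
  · rfl
  · fin_cases x <;> simp [cfg, Config.act]
  · fin_cases x <;> simp [cfg, Config.act]

theorem read_cfg (q : VState) (a b c : ℤ) (t o : ℤ → Option Bool) :
    (cfg y w q a b c t o).read = ![written y a, t b, written w c, o 0] := by
  funext x
  fin_cases x <;> rfl

variable (d : Bool) (A : List Bool → Bool)

theorem step_cfg {q : VState} (h : q ≠ .done) (h' : q ≠ .ask) (a b c : ℤ)
    (t o : ℤ → Option Bool) :
    (verifier d).step A (cfg y w q a b c t o) = (cfg y w q a b c t o).act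
      ((verifier d).δ q ![written y a, t b, written w c, o 0]) := by
  rw [DTM.step, if_neg (show (cfg y w q a b c t o).state ≠ (verifier d).final from h),
    if_neg (show (cfg y w q a b c t o).state ≠ (verifier d).pre from h'), read_cfg]
  rfl

theorem step_scan_ok (h : decide (written w 0 = some true) = d) (t o : ℤ → Option Bool) :
    (verifier d).step A (cfg y w .scan 0 0 0 t o) =
      cfg y w .copy 0 1 0 (Function.update t 0 (some false)) o := by
  rw [step_cfg _ _ _ _ (by decide) (by decide)]
  have := act_cfg y w .scan .copy 0 0 0 t o (some false) (o 0) 0 1 0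
  simp only [Function.update_eq_self] at this
  rw [show (verifier d).δ .scan ![written y 0, t 0, written w 0, o 0] = _ from if_pos h]
  refine this.trans ?_
  simp

theorem step_scan_bad (h : decide (written w 0 = some true) ≠ d) (t o : ℤ → Option Bool) :
    (verifier d).step A (cfg y w .scan 0 0 0 t o) = cfg y w .done 0 0 0 t o := by
  rw [step_cfg _ _ _ _ (by decide) (by decide)]
  have := act_cfg y w .scan .done 0 0 0 t o (t 0) (o 0) 0 0 0
  simp only [Function.update_eq_self] at this
  rw [show (verifier d).δ .scan ![written y 0, t 0, written w 0, o 0] = _ from if_neg h]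
  refine this.trans ?_
  simp

theorem step_copy_some {a b c : ℤ} {u v : Bool} (hu : written y a = some u)
    (hv : written w c = some v) (t o : ℤ → Option Bool) :
    (verifier d).step A (cfg y w .copy a b c t o) =
      cfg y w .copy (a + 1) (b + 1) (c + 1) (Function.update t b (some v)) o := by
  rw [step_cfg _ _ _ _ (by decide) (by decide)]
  have := act_cfg y w .copy .copy a b c t o (some v) (o 0) 1 1 1
  simpa [verifier, hu, hv] using this

theorem step_copy_none {a b c : ℤ} (hu : written y a = none)
    (hv : written w c = none) (t o : ℤ → Option Bool) :
    (verifier d).step A (cfg y w .copy a b c t o) =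
      cfg y w .rewind (a - 1) b c (Function.update t b (some false)) o := by
  rw [step_cfg _ _ _ _ (by decide) (by decide)]
  have := act_cfg y w .copy .rewind a b c t o (some false) (o 0) (-1) 0 0
  simpa [verifier, hu, hv, sub_eq_add_neg] using this

theorem step_copy_bad {a b c : ℤ} (h : written y a = none ↔ written w c ≠ none)
    (t o : ℤ → Option Bool) :
    (verifier d).step A (cfg y w .copy a b c t o) = cfg y w .done a b c t o := by
  rw [step_cfg _ _ _ _ (by decide) (by decide)]
  have := act_cfg y w .copy .done a b c t o (t b) (o 0) 0 0 0
  rcases hu : written y a with _ | u <;> rcases hv : written w c with _ | v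
  · simp [hu, hv] at h
  · simpa [verifier, hu, hv] using this
  · simpa [verifier, hu, hv] using this
  · simp [hu, hv] at h

theorem step_rewind_some {a b c : ℤ} (h : written y a ≠ none) (t o : ℤ → Option Bool) :
    (verifier d).step A (cfg y w .rewind a b c t o) = cfg y w .rewind (a - 1) b c t o := by
  rw [step_cfg _ _ _ _ (by decide) (by decide)]
  simp [verifier, h, act_cfg, sub_eq_add_neg]

theorem step_rewind_none {a b c : ℤ} (h : written y a = none) (t o : ℤ → Option Bool) :
    (verifier d).step A (cfg y w .rewind a b c t o) = cfg y w .test (a + 1) b c t o := by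
  rw [step_cfg _ _ _ _ (by decide) (by decide)]
  have := act_cfg y w .rewind .test a b c t o (t b) (o 0) 1 0 0
  simpa [verifier, h] using this

theorem step_test_some {a b c : ℤ} (h : written y a ≠ none) (t o : ℤ → Option Bool) :
    (verifier d).step A (cfg y w .test a b c t o) = cfg y w .ask a b c t o := by
  rw [step_cfg _ _ _ _ (by decide) (by decide)]
  simp [verifier, h, act_cfg]

theorem step_test_none {a b c : ℤ} (h : written y a = none) (t o : ℤ → Option Bool) :
    (verifier d).step A (cfg y w .test a b c t o) =
      cfg y w .done a b c t (Function.update o 0 (some true)) := by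
  rw [step_cfg _ _ _ _ (by decide) (by decide)]
  have := act_cfg y w .test .done a b c t o (t b) (some true) 0 0 0
  simpa [verifier, h] using this

theorem step_ask (a b c : ℤ) (t o : ℤ → Option Bool) :
    (verifier d).step A (cfg y w .ask a b c t o) = cfg y w .check a b c (queryTape A t) o := by
  rw [DTM.step, if_neg (show (cfg y w .ask a b c t o).state ≠ (verifier d).final from
    show VState.ask ≠ .done by decide),
    if_pos (show (cfg y w .ask a b c t o).state = (verifier d).pre from rfl)]
  ext x
  · rfl
  · rfl
  · fin_cases x <;> simp [cfg, Config.query]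

theorem step_check_eq {a b c : ℤ} {t : ℤ → Option Bool} (h : written y a = t b)
    (o : ℤ → Option Bool) :
    (verifier d).step A (cfg y w .check a b c t o) =
      cfg y w .left (a + 1) (b - 1) c (Function.update t b (some false)) o := by
  rw [step_cfg _ _ _ _ (by decide) (by decide)]
  have := act_cfg y w .check .left a b c t o (some false) (o 0) 1 (-1) 0
  simpa [verifier, h, sub_eq_add_neg] using this

theorem step_check_ne {a b c : ℤ} {t : ℤ → Option Bool} (h : written y a ≠ t b)
    (o : ℤ → Option Bool) :
    (verifier d).step A (cfg y w .check a b c t o) = cfg y w .done a b c t o := by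
  rw [step_cfg _ _ _ _ (by decide) (by decide)]
  simp [verifier, h, act_cfg]

theorem step_left_some {a b c : ℤ} {t : ℤ → Option Bool} (h : t b ≠ none)
    (o : ℤ → Option Bool) :
    (verifier d).step A (cfg y w .left a b c t o) = cfg y w .left a (b - 1) c t o := by
  rw [step_cfg _ _ _ _ (by decide) (by decide)]
  simp [verifier, h, act_cfg, sub_eq_add_neg]

theorem step_left_none {a b c : ℤ} {t : ℤ → Option Bool} (h : t b = none)
    (o : ℤ → Option Bool) :
    (verifier d).step A (cfg y w .left a b c t o) =
      cfg y w .right a (b + 1) c (Function.update t b (some true)) o := by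
  rw [step_cfg _ _ _ _ (by decide) (by decide)]
  simp [verifier, h, act_cfg]

theorem step_right_some {a b c : ℤ} {t : ℤ → Option Bool} (h : t b ≠ none)
    (o : ℤ → Option Bool) :
    (verifier d).step A (cfg y w .right a b c t o) = cfg y w .right a (b + 1) c t o := by
  rw [step_cfg _ _ _ _ (by decide) (by decide)]
  simp [verifier, h, act_cfg]

theorem step_right_none {a b c : ℤ} {t : ℤ → Option Bool} (h : t b = none)
    (o : ℤ → Option Bool) :
    (verifier d).step A (cfg y w .right a b c t o) = cfg y w .test a (b - 1) c t o := by
  rw [step_cfg _ _ _ _ (by decide) (by decide)]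
  have := act_cfg y w .right .test a b c t o (t b) (o 0) 0 (-1) 0
  rw [Function.update_eq_self] at this
  simpa [verifier, h, sub_eq_add_neg] using this

/-! #### Running time and acceptance -/

/-- From the configuration `c` the verifier halts within `B` steps, and accepts if and only if
`P` holds. -/
def Halts (B : ℕ) (c : Config VState 0) (P : Prop) : Prop :=
  ∃ t ≤ B, (((verifier d).step A)^[t] c).state = .done ∧
    ((((verifier d).step A)^[t] c).OutputsOne ↔ P)

variable {d A y w}

theorem Halts.of_step {B : ℕ} {c c' : Config VState 0} {P : Prop}
    (h : (verifier d).step A c = c') (h' : Halts d A B c' P) : Halts d A (B + 1) c P := by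
  obtain ⟨t, ht, h1⟩ := h'
  refine ⟨t + 1, by omega, ?_⟩
  rwa [Function.iterate_succ_apply, h]

theorem Halts.mono {B B' : ℕ} {c : Config VState 0} {P : Prop} (h : Halts d A B c P)
    (hB : B ≤ B') : Halts d A B' c P := by
  obtain ⟨t, ht, h1⟩ := h
  exact ⟨t, ht.trans hB, h1⟩

/-- A final configuration is fixed by `step`, so halting early does no harm when the machine is
inspected at exactly time `B`, as in the definition of `NP`. -/
theorem Halts.at {B : ℕ} {c : Config VState 0} {P : Prop} (h : Halts d A B c P) :
    (((verifier d).step A)^[B] c).state = .done ∧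
      ((((verifier d).step A)^[B] c).OutputsOne ↔ P) := by
  obtain ⟨t, ht, h1⟩ := h
  obtain ⟨r, rfl⟩ := Nat.exists_eq_add_of_le' ht
  rw [Function.iterate_add_apply, Function.iterate_fixed]
  · exact h1
  · rw [DTM.step, if_pos (show _ = (verifier d).final from h1.1)]

theorem halts_done {B : ℕ} {P : Prop} (a b c : ℤ) (t o : ℤ → Option Bool)
    (h : o 0 = some true ↔ P) : Halts d A B (cfg y w .done a b c t o) P :=
  ⟨0, Nat.zero_le _, rfl, h⟩

/-- Here `m` counts the cells of the block from its left end up to the head, that is, the moves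
still to be made before the blank. -/
theorem halts_left {B : ℕ} {P : Prop} {a c e : ℤ} {u : List Bool} {o : ℤ → Option Bool} :
    ∀ (m : ℕ), m ≤ u.length →
      Halts d A B (cfg y w .right a e c (strip (e - 1) (true :: u)) o) P →
      Halts d A (B + 1 + m) (cfg y w .left a (e + m - 1) c (strip e u) o) P
  | 0, _, h => by
    refine Halts.of_step (step_left_none _ _ _ _ ?_ _) ?_
    · exact strip_eq_none_iff.2 (Or.inl (by simp))
    · simpa [update_strip_pred] using h
  | m + 1, hm, h => by
    refine Halts.of_step (step_left_some _ _ _ _ ?_ _) ?_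
    · rw [ne_eq, strip_eq_none_iff]; push_cast; omega
    · have := halts_left m (by omega) h
      rwa [show e + ((m + 1 : ℕ) : ℤ) - 1 - 1 = e + m - 1 by push_cast; ring]

theorem halts_right {B : ℕ} {P : Prop} {a c e : ℤ} {u : List Bool} {o : ℤ → Option Bool} :
    ∀ (m : ℕ), m ≤ u.length →
      Halts d A B (cfg y w .test a (e + u.length - 1) c (strip e u) o) P →
      Halts d A (B + 1 + m) (cfg y w .right a (e + u.length - m) c (strip e u) o) P
  | 0, _, h => by
    refine Halts.of_step (step_right_none _ _ _ _ ?_ _) ?_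
    · exact strip_eq_none_iff.2 (Or.inr (by simp))
    · simpa using h
  | m + 1, hm, h => by
    refine Halts.of_step (step_right_some _ _ _ _ ?_ _) ?_
    · rw [ne_eq, strip_eq_none_iff]; push_cast; omega
    · have := halts_right m (by omega) h
      rwa [show e + (u.length : ℤ) - ((m + 1 : ℕ) : ℤ) + 1 = e + u.length - m by push_cast; ring]

theorem halts_rewind {B : ℕ} {P : Prop} {b c : ℤ} {t o : ℤ → Option Bool}
    (h : Halts d A B (cfg y w .test 0 b c t o) P) :
    ∀ (m : ℕ), m ≤ y.length →
      Halts d A (B + 1 + m) (cfg y w .rewind (m - 1) b c t o) P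
  | 0, _ => by
    refine Halts.of_step (step_rewind_none _ _ _ _ ?_ _ _) ?_
    · rw [written_eq_strip]; exact strip_eq_none_iff.2 (Or.inl (by simp))
    · simpa using h
  | m + 1, hm => by
    refine Halts.of_step (step_rewind_some _ _ _ _ ?_ _ _) ?_
    · rw [written_eq_strip, ne_eq, strip_eq_none_iff]; push_cast; omega
    · have := halts_rewind h m (by omega)
      rwa [show ((m + 1 : ℕ) : ℤ) - 1 - 1 = m - 1 by push_cast; ring]

theorem pairing_length (i : ℕ) : (pairing w i).length = i + 1 + w.length := by
  simp [pairing]; omega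

theorem pairing_succ (i : ℕ) : pairing w (i + 1) = true :: pairing w i := by
  simp [pairing, List.replicate_succ]

/-- Loop invariant: before bit `i` is tested, the query tape holds `1ⁱ 0 w 0` from cell `-i`. The
block grows to the left, so the answer cell stays at `w.length + 1`, and `m` rounds remain. -/
theorem halts_test (hw : w.length = y.length) {c : ℤ} {o : ℤ → Option Bool}
    (ho : o 0 ≠ some true) : ∀ (m i : ℕ), i + m = y.length →
      Halts d A (m * (4 * y.length + 10) + 1)
        (cfg y w .test i (w.length + 1) c (strip (-i) (pairing w i ++ [false])) o)
        (∀ j, i ≤ j → j < y.length → y[j]? = some (A (pairing w j)))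
  | 0, i, hi => by
    refine Halts.of_step (step_test_none _ _ _ _ ?_ _ _) ?_
    · rw [written_eq_strip, strip_eq_none_iff]; omega
    · refine halts_done _ _ _ _ _ ?_
      simp only [Function.update_self, true_iff]
      intro j h1 h2; omega
  | m + 1, i, hi => by
    have hwr : written y i = y[i]? := by simp [written]
    have hy : y[i]? = some y[i] := List.getElem?_eq_getElem (by omega)
    have hpos : ((w.length : ℤ) + 1) = -(i : ℤ) + (pairing w i).length := by
      rw [pairing_length]; push_cast; ring
    have ih := halts_test hw (c := c) (o := o) ho m (i + 1) (by omega)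
    -- From right to left: one step each for `test`, `ask` and `check`, then the walk to the left
    -- end, the walk back, and the remaining rounds. Since `i < y.length`, one round fits into `4 *
    -- y.length + 10` steps.
    refine Halts.mono (B := m * (4 * y.length + 10) + 1 + 1 + (i + y.length + 2) + 1 +
      (i + y.length + 1) + 1 + 1 + 1) ?_ (by
        have e : (m + 1) * (4 * y.length + 10) = m * (4 * y.length + 10) + (4 * y.length + 10) := by
          ring
        rw [e]; omega)
    refine Halts.of_step (step_test_some _ _ _ _ (by rw [hwr, hy]; simp) _ _)
      (Halts.of_step (step_ask _ _ _ _ _ _ _ _ _) ?_)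
    rw [queryTape_strip]
    have hread : strip (-(i : ℤ)) (pairing w i ++ [A (pairing w i)]) (w.length + 1) =
        some (A (pairing w i)) := by
      rw [hpos, strip_append_singleton]
    by_cases heq : y[i]? = some (A (pairing w i))
    · refine Halts.of_step (step_check_eq _ _ _ _ (by rw [hwr, hread, heq]) _) ?_
      have hP : (∀ j, i ≤ j → j < y.length → y[j]? = some (A (pairing w j))) ↔
          ∀ j, i + 1 ≤ j → j < y.length → y[j]? = some (A (pairing w j)) := by
        refine ⟨fun h j hj => h j (by omega), fun h j hj hj' => ?_⟩
        rcases Nat.eq_or_lt_of_le hj with rfl | hlt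
        · exact heq
        · exact h j hlt hj'
      rw [hP, hpos, update_strip_append]
      have hr := halts_right (a := ((i + 1 : ℕ) : ℤ)) (e := -((i + 1 : ℕ) : ℤ))
        (u := pairing w (i + 1) ++ [false]) (i + y.length + 2)
        (by rw [List.length_append, pairing_length, List.length_singleton]; omega)
        (B := m * (4 * y.length + 10) + 1) (by
          convert ih using 2
          rw [List.length_append, pairing_length]; push_cast; simp; ring)
      have hl := halts_left (a := ((i + 1 : ℕ) : ℤ)) (e := -(i : ℤ))
        (u := pairing w i ++ [false]) (i + y.length + 1)
        (by rw [List.length_append, pairing_length, List.length_singleton]; omega)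
        (c := c) (o := o) (y := y) (w := w) (by
          convert hr using 2
          · rw [List.length_append, pairing_length, hw]; push_cast; simp; ring
          · rw [pairing_succ, List.cons_append]; push_cast; congr 1; ring)
      convert hl using 2
      · push_cast; ring
      · rw [pairing_length, hw]; push_cast; ring
    · refine Halts.of_step (step_check_ne _ _ _ _ (by rwa [hwr, hread]) _)
        (halts_done _ _ _ _ _ ?_)
      exact iff_of_false ho fun h => heq (h i le_rfl (by omega))

/-- The bound involves the length of `y` only: copying stops at the end of the input even if the
certificate is longer. -/
theorem halts_copy {o : ℤ → Option Bool} (ho : o 0 ≠ some true) :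
    ∀ (m j : ℕ), j + m = y.length → j ≤ w.length →
      Halts d A (m + 1 + (y.length + 1) + (y.length * (4 * y.length + 10) + 1))
        (cfg y w .copy j (j + 1) j (strip 0 (false :: w.take j)) o)
        (w.length = y.length ∧ ∀ i < y.length, y[i]? = some (A (pairing w i)))
  | 0, j, hj, hjw => by
    have hyj : written y j = none := by
      rw [written_eq_strip, strip_eq_none_iff]; omega
    by_cases hw : w.length = j
    · have hwj : written w j = none := by
        rw [written_eq_strip, strip_eq_none_iff]; omega
      have ht := halts_test (d := d) (A := A) (y := y) (w := w) (by omega) (c := j) ho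
        y.length 0 (by omega)
      have hr := halts_rewind ht y.length le_rfl
      refine Halts.mono (B := y.length * (4 * y.length + 10) + 1 + 1 + y.length + 1)
        (Halts.of_step (step_copy_none _ _ _ _ hyj hwj _ _) ?_) (by omega)
      have e : Function.update (strip 0 (false :: w.take j)) ((j : ℤ) + 1) (some false) =
          strip (-((0 : ℕ) : ℤ)) (pairing w 0 ++ [false]) := by
        have := update_strip_length 0 (false :: w.take j) false
        rw [List.take_of_length_le hw.le] at this ⊢
        simpa [hw, pairing] using this
      rw [e]
      convert hr using 2
      · omega
      · omega
      · simp only [Nat.zero_le, forall_const]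
        exact and_iff_right (by omega)
    · refine Halts.mono (B := 0 + 1) (Halts.of_step (step_copy_bad _ _ _ _ ?_ _ _)
        (halts_done _ _ _ _ _ ?_)) (by omega)
      · refine iff_of_true hyj ?_
        rw [written_eq_strip, ne_eq, strip_eq_none_iff]; omega
      · exact iff_of_false ho fun h => hw (by omega)
  | m + 1, j, hj, hjw => by
    have hyj : written y j = some y[j] := by
      rw [show written y j = y[j]? by simp [written]]
      exact List.getElem?_eq_getElem (by omega)
    by_cases hw : j < w.length
    · have hwj : written w j = some w[j] := by
        rw [show written w j = w[j]? by simp [written]]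
        exact List.getElem?_eq_getElem hw
      have ih := halts_copy ho m (j + 1) (by omega) hw
      refine Halts.mono (Halts.of_step (step_copy_some _ _ _ _ hyj hwj _ _) ?_)
        (show m + 1 + (y.length + 1) + (y.length * (4 * y.length + 10) + 1) + 1 ≤ _ by omega)
      have e : Function.update (strip 0 (false :: w.take j)) ((j : ℤ) + 1) (some w[j]) =
          strip 0 (false :: w.take (j + 1)) := by
        have := update_strip_length 0 (false :: w.take j) w[j]
        rw [List.take_succ_eq_append_getElem hw]
        simpa [hw.le] using this
      rw [e]
      exact_mod_cast ih
    · refine Halts.mono (B := 0 + 1) (Halts.of_step (step_copy_bad _ _ _ _ ?_ _ _)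
        (halts_done _ _ _ _ _ ?_)) (by omega)
      · refine iff_of_false (by simp [hyj]) (not_not.2 ?_)
        rw [written_eq_strip, strip_eq_none_iff]; omega
      · exact iff_of_false ho fun h => hw (by omega)

theorem halts_start : Halts d A (4 * y.length ^ 2 + 20 * y.length + 20)
    (Config.start VState.scan y w)
    (decide (w.head? = some true) = d ∧ w.length = y.length ∧
      ∀ i < y.length, y[i]? = some (A (pairing w i))) := by
  have hs : (Config.start VState.scan y w : Config VState 0) =
      cfg y w .scan 0 0 0 (strip 0 []) (strip 0 []) := by
    ext x
    · rfl
    · fin_cases x <;> rfl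
    · fin_cases x <;> simp [Config.start, cfg, written_eq_strip]
  have hh : written w 0 = w.head? := by cases w <;> simp [written]
  have ho : strip 0 [] 0 ≠ some true := by simp [strip]
  rw [hs]
  by_cases hd : decide (w.head? = some true) = d
  · refine Halts.mono (Halts.of_step (step_scan_ok _ _ _ _ (by rw [hh]; exact hd) _ _) ?_)
      (show y.length + 1 + (y.length + 1) + (y.length * (4 * y.length + 10) + 1) + 1 ≤ _ by
        nlinarith)
    have h := halts_copy (d := d) (A := A) (y := y) (w := w) ho y.length 0 (by omega) (by omega)
    have e : Function.update (strip 0 []) 0 (some false) = strip 0 (false :: w.take 0) := by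
      simpa using update_strip_length 0 [] false
    rw [e]
    simpa [hd] using h
  · refine Halts.mono (B := 0 + 1) (Halts.of_step (step_scan_bad _ _ _ _ (by rwa [hh]) _ _)
      (halts_done _ _ _ _ _ ?_)) (by omega)
    exact iff_of_false ho fun h => hd h.1

end Verifier

/-! ### From the verifier to the complexity classes -/

section Membership

variable (π : PermFamily)

theorem PermFamily.length_toFun (x : List Bool) : (π.toFun x).length = x.length := by
  simp [PermFamily.toFun]

theorem PermFamily.toFun_bijective : Function.Bijective π.toFun := by
  have ex : ∀ (n : ℕ) (l : List Bool), l.length = n → ∃ v : Fin n → Bool, l = List.ofFn v := by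
    rintro _ l rfl
    exact ⟨l.get, (List.ofFn_get l).symm⟩
  constructor
  · intro x x' h
    obtain ⟨n, hn⟩ : ∃ n, x.length = n := ⟨_, rfl⟩
    obtain ⟨v, rfl⟩ := ex n x hn
    obtain ⟨v', rfl⟩ := ex n x' (by rw [← π.length_toFun, ← h, π.length_toFun, List.length_ofFn])
    rw [π.toFun_ofFn, π.toFun_ofFn] at h
    rw [(π _).injective (List.ofFn_injective h)]
  · intro y
    obtain ⟨n, hn⟩ : ∃ n, y.length = n := ⟨_, rfl⟩
    obtain ⟨v, rfl⟩ := ex n y hn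
    exact ⟨List.ofFn ((π _).symm v), by rw [π.toFun_ofFn, Equiv.apply_symm_apply]⟩

theorem PermFamily.toFun_eq_iff (w y : List Bool) :
    π.toFun w = y ↔ w.length = y.length ∧
      ∀ i < y.length, y[i]? = some (π.oracle (pairing w i)) := by
  have ho : ∀ i < w.length, (π.toFun w)[i]? = some (π.oracle (pairing w i)) := by
    intro i hi
    rw [PermFamily.oracle, unpair_pairing]
    simp only
    rw [List.getD_eq_getElem?_getD,
      List.getElem?_eq_getElem (by rwa [π.length_toFun]), Option.getD_some]
  constructor
  · rintro rfl
    exact ⟨(π.length_toFun w).symm, fun i hi => ho i (by rwa [← π.length_toFun])⟩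
  · rintro ⟨h1, h2⟩
    refine List.ext_getElem? fun i => ?_
    by_cases hi : i < y.length
    · rw [ho i (by omega), h2 i hi]
    · rw [List.getElem?_eq_none (by rw [π.length_toFun]; omega),
        List.getElem?_eq_none (by omega)]

/-- The only certificate that can be accepted is the preimage, whose length is that of `y`. The two
values of `d` yield the language of preimages and its complement. -/
theorem PermFamily.mem_NP (d : Bool) :
    {y | ∃ w, π.toFun w = y ∧ decide (w.head? = some true) = d} ∈ NP π.oracle := by
  refine ⟨VState, inferInstance, 0, verifier d,
    4 * Polynomial.X ^ 2 + 20 * Polynomial.X + 20, fun y => ?_⟩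
  have he : (4 * Polynomial.X ^ 2 + 20 * Polynomial.X + 20 : Polynomial ℕ).eval y.length =
      4 * y.length ^ 2 + 20 * y.length + 20 := by simp
  rw [he]
  have key := fun w : List Bool =>
    (Verifier.halts_start (d := d) (A := π.oracle) (y := y) (w := w)).at
  refine ⟨fun w _ => (key w).1, ?_⟩
  constructor
  · rintro ⟨w, hw, hd⟩
    have h := (π.toFun_eq_iff w y).1 hw
    exact ⟨w, by rw [h.1]; nlinarith, (key w).2.2 ⟨hd, h⟩⟩
  · rintro ⟨w, -, hw⟩
    obtain ⟨hd, h⟩ := (key w).2.1 hw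
    exact ⟨w, (π.toFun_eq_iff w y).2 h, hd⟩

theorem PermFamily.preimageLanguage_mem : π.preimageLanguage ∈ NP π.oracle ∩ coNP π.oracle := by
  constructor
  · convert π.mem_NP true using 1
    ext y
    simp [PermFamily.preimageLanguage]
  · rw [coNP, Set.mem_ofPred_eq]
    convert π.mem_NP false using 1
    ext y
    simp only [PermFamily.preimageLanguage, Set.mem_compl_iff, Set.mem_ofPred_eq,
      decide_eq_false_iff_not]
    constructor
    · intro h
      -- Every string has a preimage, and only one, so the complement is also described by the
      -- existence of a certificate.
      obtain ⟨w, hw⟩ := π.toFun_bijective.2 y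
      exact ⟨w, hw, fun hw' => h ⟨w, hw, hw'⟩⟩
    · rintro ⟨w, rfl, hw⟩ ⟨w', hw', h⟩
      exact hw (π.toFun_bijective.1 hw' ▸ h)

end Membership

/-! ### A fixed machine fails almost surely -/

open scoped Classical in
/-- A fixed well-formed quantum machine almost surely does not decide the language of preimages in
time `T`, if `T n = o(2 ^ (n / 2))`. -/
theorem QTM.WellFormed.ae_not_decides {Q : Type} [Fintype Q] {k : ℕ} {M : QTM Q k}
    (hM : M.WellFormed) {T : ℕ → ℝ} (hT : ∀ᶠ n in atTop, 288 * T n ≤ √(2 ^ n)) :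
    ∀ᵐ π : PermFamily ∂randomPerm, ¬ ∀ x : List Bool, ∃ t : ℕ, (t : ℝ) ≤ T x.length ∧
      M.HaltsAt π.oracle x t ∧
      (x ∈ π.preimageLanguage → 2 / 3 ≤ probOf (M.run π.oracle x t) Config.OutputsOne) ∧
      (x ∉ π.preimageLanguage →
        2 / 3 ≤ probOf (M.run π.oracle x t) fun c => ¬ c.OutputsOne) := by
  obtain ⟨n₀, hn₀⟩ := eventually_atTop.1 hT
  let y : ∀ n, Fin n → Bool := fun n _ => false
  -- One test string `0ⁿ` for each length suffices. The existential over `hn` makes the proposition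
  -- false at `n = 0`, where there is no first bit. For negative `T n` the floor is `0`, which only
  -- weakens the event.
  let E : ℕ → Set PermFamily := fun n => {π | M.Decides π.oracle (List.ofFn (y n)) ⌊T n⌋₊
    (∃ hn : 0 < n, (π n).symm (y n) ⟨0, hn⟩ = true)}
  have h0 : randomPerm (⋂ n, E n) = 0 := by
    refine measure_iInter_eq_zero (n₀ := max n₀ 1) (fun n _ => ?_) fun n hn π => ?_
    · obtain ⟨I, hI⟩ :=
        (M.finitelyDetermined_decides (List.ofFn (y n)) ⌊T n⌋₊).dependsOn
      refine ⟨insert n I, fun π π' h => ?_⟩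
      have e1 := hI fun i hi => h i (by simp_all)
      have e2 : π n = π' n := h n (by simp)
      simp only at e1
      simp only [E, Set.mem_ofPred_eq, e1, e2]
    · have hn1 : 0 < n := by omega
      have hK : 288 * (⌊T n⌋₊ : ℝ) ≤ √(2 ^ n) := by
        rcases le_total (T n) 0 with hneg | hpos
        · simp [Nat.floor_of_nonpos hneg]
        · exact (mul_le_mul_of_nonneg_left (Nat.floor_le hpos) (by norm_num)).trans
            (hn₀ n (by omega))
      have := hM.card_decides_le π hn1 (List.ofFn (y n)) (y n) hK
      simpa [E, hn1] using this
  rw [← compl_mem_ae_iff] at h0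
  filter_upwards [h0] with π hπ hdec
  refine hπ (Set.mem_iInter.2 fun n => ?_)
  obtain ⟨t, ht, hh, h1, h2⟩ := hdec (List.ofFn (y n))
  rw [List.length_ofFn] at ht
  have hiff : List.ofFn (y n) ∈ π.preimageLanguage ↔
      ∃ hn : 0 < n, (π n).symm (y n) ⟨0, hn⟩ = true := by
    rcases Nat.eq_zero_or_pos n with rfl | hn
    · simp only [lt_irrefl, IsEmpty.exists_iff, iff_false]
      rintro ⟨x, hx, hx1⟩
      have hl := congrArg List.length hx
      rw [π.length_toFun, List.length_ofFn, List.length_eq_zero_iff] at hl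
      simp [hl] at hx1
    · rw [π.ofFn_mem_preimageLanguage hn]
      simp [hn]
  exact ⟨t, Nat.le_floor ht, hh, fun h => h1 (hiff.2 h), fun h => h2 fun h' => h (hiff.1 h')⟩

/-- The adversary bound allows times up to order `2 ^ (n / 2)`, so the exponent `n / 3` leaves room
to spare. -/
theorem eventually_le_sqrt {T : ℕ → ℝ}
    (hT : T =o[atTop] fun n : ℕ => (2 : ℝ) ^ ((n : ℝ) / 3)) :
    ∀ᶠ n in atTop, 288 * T n ≤ √(2 ^ n) := by
  filter_upwards [hT.bound (show (0 : ℝ) < 1 / 288 by norm_num)] with n hn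
  have h1 : T n ≤ 1 / 288 * (2 : ℝ) ^ ((n : ℝ) / 3) := by
    refine (le_abs_self _).trans ?_
    rwa [Real.norm_eq_abs, Real.norm_of_nonneg (by positivity)] at hn
  have h2 : (2 : ℝ) ^ ((n : ℝ) / 3) ≤ √(2 ^ n) := by
    rw [Real.sqrt_eq_rpow, ← Real.rpow_natCast, ← Real.rpow_mul (by norm_num)]
    refine Real.rpow_le_rpow_of_exponent_le (by norm_num) ?_
    have : (0 : ℝ) ≤ n := Nat.cast_nonneg n
    linarith
  linarith

end QOracle

end

theorem theorem3p6 (T : ℕ → ℝ)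
    (hT : T =o[atTop] fun n : ℕ => (2 : ℝ) ^ ((n : ℝ) / 3)) :
    ∀ᵐ π : QOracle.PermFamily ∂QOracle.randomPerm,
      ¬ (QOracle.NP π.oracle ∩ QOracle.coNP π.oracle ⊆ QOracle.BQTime T π.oracle) ∧
      π.preimageLanguage ∈ QOracle.NP π.oracle ∩ QOracle.coNP π.oracle ∧
      π.preimageLanguage ∉ QOracle.BQTime T π.oracle := by
  have hT' := QOracle.eventually_le_sqrt hT
  have h : ∀ᵐ π : QOracle.PermFamily ∂QOracle.randomPerm,
      π.preimageLanguage ∉ QOracle.BQTime T π.oracle := by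
    -- Countability of the machines allows the exceptional null sets to be united.
    have h := ae_all_iff.2 fun s : ℕ => ae_all_iff.2 fun k : ℕ =>
      ae_all_iff.2 fun M : QOracle.QTM (Fin s) k => ae_all_iff.2 fun hM : M.WellFormed =>
        hM.ae_not_decides hT'
    filter_upwards [h] with π hπ
    rintro ⟨s, k, M, hM, hd⟩
    exact hπ s k M hM hd
  filter_upwards [h] with π hπ
  have hmem := π.preimageLanguage_mem
  exact ⟨fun hsub => hπ (hsub hmem), hmem, hπ⟩
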